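/- Let $k$ be a quadratic number field with discriminant $d = d_1d_2d_3$, where $d_1, d_2, d_3$ are discriminants of quadratic number fields, and let all fields below be contained in a fixed extension field $\Omega$ of $k$ (for instance an algebraic closure of $k$). An $H_8$-extension of $k$ is a finite Galois extension of $k$ whose Galois group is isomorphic to the quaternion group $H_8$ of order $8$; it is called unramified if no finite prime of $k$ ramifies in it. Put $K = k(\sqrt{d_1}, \sqrt{d_2}, \sqrt{d_3}\,)$, and assume that $M = K(\sqrt{\mu}\,)$, with $\mu \in K$, and $N$ are unramified $H_8$-extensions of $k$ which both contain $K$. Then there exists a discriminant $\delta$ of a quadratic number field such that $\delta \mid d$ and $N = K(\sqrt{\delta\mu}\,)$. -/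

import Mathlib

open scoped NumberField

/-- `D` is the discriminant of some quadratic number field. -/
def IsQuadraticDiscriminant (D : ℤ) : Prop :=
  ∃ (F : Type) (_ : Field F) (_ : NumberField F),
    Module.finrank ℚ F = 2 ∧ NumberField.discr F = D

/-- The extension `L / k` is unramified at all finite primes (no condition is imposed at the
infinite places): every nonzero prime ideal of the ring of integers of `k` is unramified
in the ring of integers of `L`. -/
def IsUnramifiedExtension (k L : Type*) [Field k] [Field L] [Algebra k L] : Prop :=
  ∀ p : Ideal (𝓞 k), p.IsPrime → p ≠ ⊥ → Algebra.IsUnramifiedIn (𝓞 L) p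

/-- `L / k` is a finite Galois extension whose Galois group is the quaternion group of order 8
(in Mathlib `QuaternionGroup n` has order `4 * n`). -/
def IsH8Extension (k L : Type*) [Field k] [Field L] [Algebra k L] : Prop :=
  FiniteDimensional k L ∧ IsGalois k L ∧ Nonempty ((L ≃ₐ[k] L) ≃* QuaternionGroup 2)

/-- The field `K(r)`, for `K` between `k` and `Ω` and `r` in `Ω`, as an extension of `k`. -/
def adjoinOver {k Ω : Type*} [Field k] [Field Ω] [Algebra k Ω] (K : IntermediateField k Ω)
    (r : Ω) : IntermediateField k Ω :=
  (IntermediateField.adjoin K {r}).restrictScalars k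

/-! Write M = K(√μ), N = K(√ν) and w = √μ·√ν. In the quaternion group every element other than ±1
squares to -1. So for an automorphism γ over k one has γ²√μ = -√μ if γ acts nontrivially on K and
γ²√μ = √μ otherwise, and likewise for √ν. The signs cancel in w: the Galois group acts on the line
K·w through involutions. These commute, hence have a common eigenvector κw with eigenvalues ±1, and
a = (κw)² lies in k (`exists_sq_mem_of_involutive_action`).

Now √a lies in the compositum MN. Inside a field L that contains MN and is Galois over ℚ, consider
the subfield fixed by all inertia groups over k. It contains M and N, it is stable under Gal(L/ℚ),
and every finite valuation of k extends to it with values still in ℤ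
(`exists_valuation_unramifiedPart`).

The rest is genus theory for k = ℚ(√D) (`exists_discriminant_of_sq`). All valuations of a are even,
so its norm is ±n². For the plus sign, Hilbert 90 makes a a squarefree integer r times a square, and
ramification leaves only the case that r or D/r is a divisor of d congruent to 1 mod 4; this is δ.
For the minus sign, √a and its conjugate produce √-1, which is impossible. Hence μν is δ times a
square in K; if δ = 1, it is replaced by d₁, a square in K. -/

open WithZero IsDedekindDomain

/-! ### Squarefree parts of rational numbers -/

theorem Rat.exists_int_of_squarefree_mul_sq {D : ℤ} (hD : Squarefree D) {t : ℚ} {m : ℤ}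
    (h : (D : ℚ) * t ^ 2 = m) : ∃ n : ℤ, t = n := by
  have hden : (t.den : ℤ) * t.den ∣ D := by
    have h1 : D * t.num ^ 2 = m * (t.den : ℤ) ^ 2 := by
      have hd : (t.den : ℚ) ≠ 0 := by exact_mod_cast t.den_ne_zero
      have := t.num_div_den
      rw [← this] at h
      field_simp at h
      rw [mul_comm m]
      exact_mod_cast h
    have hc : IsCoprime ((t.den : ℤ) * t.den) (t.num ^ 2) := by
      have := Int.isCoprime_iff_gcd_eq_one.mpr (show Int.gcd t.den t.num = 1 by
        rw [Int.gcd_comm]; simpa [Int.gcd] using t.reduced)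
      exact (this.mul_left this).pow_right
    refine hc.dvd_of_dvd_mul_right (Dvd.intro_left m ?_)
    rw [h1]; ring
  have hu := hD _ hden
  refine ⟨t.num, ?_⟩
  have : t.den = 1 := by simpa [Int.isUnit_iff_natAbs_eq] using hu
  exact (Rat.den_eq_one_iff t).mp this |>.symm

theorem Rat.sq_ne_squarefree {D : ℤ} (hD : Squarefree D) (hD1 : D ≠ 1) (t : ℚ) :
    t ^ 2 ≠ D := by
  intro h
  have h' : ((1 : ℤ) : ℚ) * t ^ 2 = D := by simpa using h
  obtain ⟨n, rfl⟩ := Rat.exists_int_of_squarefree_mul_sq squarefree_one h'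
  have h2 : n * n = D := by rw [← sq]; exact_mod_cast h
  have hu := hD n ⟨1, by rw [h2, mul_one]⟩
  rcases Int.isUnit_iff.mp hu with rfl | rfl <;> simp at h2 <;> exact hD1 h2.symm

theorem Rat.exists_squarefree_mul_sq {e : ℚ} (he : e ≠ 0) :
    ∃ (D : ℤ) (c : ℚ), Squarefree D ∧ c ≠ 0 ∧ e = D * c ^ 2 := by
  obtain ⟨a, b, hab, ha⟩ := Nat.sq_mul_squarefree (e.num * e.den).natAbs
  have hd : (e.den : ℚ) ≠ 0 := by exact_mod_cast e.den_ne_zero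
  have hne : e.num * e.den ≠ 0 :=
    mul_ne_zero (Rat.num_ne_zero.mpr he) (by exact_mod_cast e.den_ne_zero)
  have hb : b ≠ 0 := by
    rintro rfl
    simp at hab
    omega
  refine ⟨(e.num * e.den).sign * a, b / e.den, ?_, by positivity, ?_⟩
  · rw [← Int.squarefree_natAbs, Int.natAbs_mul, Int.natAbs_sign_of_ne_zero hne]
    simpa using ha
  · have h1 : (e.num * e.den) = (e.num * e.den).sign * (b ^ 2 * a) := by
      conv_lhs => rw [← Int.sign_mul_natAbs (e.num * e.den)]
      rw [← hab]; push_cast; ring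
    have h2 : (e.num : ℚ) * e.den = ((e.num * e.den).sign : ℤ) * ((b : ℚ) ^ 2 * a) := by
      exact_mod_cast h1
    calc e = (e.num * e.den) / e.den ^ 2 := by
            conv_lhs => rw [← Rat.num_div_den e]
            field_simp
      _ = _ := by rw [h2]; push_cast; field_simp

/-! ### Quadratic fields: trace, norm, integers, discriminant -/

section QuadraticField

variable {F : Type*} [Field F] [NumberField F]

theorem exists_sq_eq_squarefree_of_finrank_eq_two (hF : Module.finrank ℚ F = 2) :
    ∃ (D : ℤ) (θ : F), Squarefree D ∧ D ≠ 1 ∧ θ ^ 2 = D := by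
  obtain ⟨x, hx⟩ : ∃ x : F, x ∉ (algebraMap ℚ F).range := by
    by_contra! h
    have : (⊥ : Subalgebra ℚ F) = ⊤ := by
      rw [eq_top_iff]
      intro x _
      exact Algebra.mem_bot.mpr (h x)
    have := Subalgebra.bot_eq_top_iff_finrank_eq_one.mp this
    omega
  have hdep : ¬ LinearIndependent ℚ ![1, x, x ^ 2] := by
    intro h
    have := h.fintype_card_le_finrank
    simp [hF] at this
  obtain ⟨g, hg, i, hi⟩ := Fintype.not_linearIndependent_iff.mp hdep
  have hg' : (g 0 : F) + g 1 * x + g 2 * x ^ 2 = 0 := by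
    simpa [Fin.sum_univ_three, Algebra.smul_def] using hg
  have hg2 : g 2 ≠ 0 := by
    intro h2
    rw [h2] at hg'
    have h1 : g 1 = 0 := by
      by_contra h1
      refine hx ⟨-g 0 / g 1, ?_⟩
      have : (g 1 : F) ≠ 0 := by exact_mod_cast h1
      simp only [eq_ratCast]
      push_cast
      field_simp
      push_cast at hg'
      linear_combination -hg'
    rw [h1] at hg'
    have h0 : g 0 = 0 := by
      push_cast at hg'
      have : (g 0 : F) = 0 := by linear_combination hg'
      exact_mod_cast this
    fin_cases i <;> simp_all
  -- Completing the square: y² is the discriminant of the quadratic relation satisfied by x.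
  set y : F := 2 * g 2 * x + g 1 with hy
  have hy2 : y ^ 2 = ((g 1 ^ 2 - 4 * g 0 * g 2 : ℚ) : F) := by
    push_cast
    linear_combination (4 * (g 2 : F)) * hg'
  have hyr : ∀ q : ℚ, y ≠ q := by
    intro q hq
    refine hx ⟨(q - g 1) / (2 * g 2), ?_⟩
    have : (g 2 : F) ≠ 0 := by exact_mod_cast hg2
    simp only [eq_ratCast]
    push_cast
    rw [← hq, hy]
    field_simp
    ring
  have he : (g 1 ^ 2 - 4 * g 0 * g 2 : ℚ) ≠ 0 := by
    intro h
    rw [h] at hy2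
    exact hyr 0 (by simpa using hy2)
  obtain ⟨D, c, hD, hc, hDc⟩ := Rat.exists_squarefree_mul_sq he
  have hc' : (c : F) ≠ 0 := by exact_mod_cast hc
  have hsq : (y / c) ^ 2 = D := by
    rw [div_pow, hy2, hDc]
    push_cast
    field_simp
  refine ⟨D, y / c, hD, ?_, hsq⟩
  rintro rfl
  have : (y / c) ^ 2 = 1 := by simpa using hsq
  rcases sq_eq_sq_iff_eq_or_eq_neg.mp (this.trans (one_pow 2).symm) with h | h
  · exact hyr c (by field_simp at h; exact h)
  · exact hyr (-c) (by field_simp at h; simpa using h)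

variable (hF : Module.finrank ℚ F = 2) {D : ℤ} (hD : Squarefree D) (hD1 : D ≠ 1) {θ : F}
  (hθ : θ ^ 2 = D)

include hD hD1 hθ in
theorem ne_ratCast_of_sq_eq_squarefree (q : ℚ) : θ ≠ q := by
  rintro rfl
  refine Rat.sq_ne_squarefree hD hD1 q ?_
  exact_mod_cast hθ

include hD hD1 hθ in
theorem linearIndependent_one_add_mul {e f : ℚ} (hf : f ≠ 0) :
    LinearIndependent ℚ ![(1 : F), e + f * θ] := by
  rw [LinearIndependent.pair_iff]
  intro s t h
  have h' : (s + t * e : F) + t * f * θ = 0 := by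
    simp only [Algebra.smul_def, eq_ratCast] at h
    linear_combination h
  have ht : t = 0 := by
    by_contra ht
    refine ne_ratCast_of_sq_eq_squarefree hD hD1 hθ (-(s + t * e) / (t * f)) ?_
    have h1 : (t : F) ≠ 0 := by exact_mod_cast ht
    have h2 : (f : F) ≠ 0 := by exact_mod_cast hf
    push_cast
    field_simp
    linear_combination h'
  subst ht
  simpa using h'

/-- The `ℚ`-basis `1, e + f * θ` of a quadratic field containing a square root `θ` of a
squarefree integer. -/
noncomputable def quadraticBasis (e : ℚ) {f : ℚ} (hf : f ≠ 0) : Module.Basis (Fin 2) ℚ F :=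
  basisOfLinearIndependentOfCardEqFinrank (linearIndependent_one_add_mul hD hD1 hθ (e := e) hf)
    (by simp [hF])

@[simp]
theorem quadraticBasis_zero (e : ℚ) {f : ℚ} (hf : f ≠ 0) :
    quadraticBasis hF hD hD1 hθ e hf 0 = 1 := by
  simp [quadraticBasis]

@[simp]
theorem quadraticBasis_one (e : ℚ) {f : ℚ} (hf : f ≠ 0) :
    quadraticBasis hF hD hD1 hθ e hf 1 = e + f * θ := by
  simp [quadraticBasis]

theorem quadraticBasis_repr (e : ℚ) {f : ℚ} (hf : f ≠ 0) (p q : ℚ) :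
    ⇑((quadraticBasis hF hD hD1 hθ e hf).repr (p + q * θ)) = ![p - q * e / f, q / f] := by
  have h : (p + q * θ : F) = (p - q * e / f) • quadraticBasis hF hD hD1 hθ e hf 0 +
      (q / f) • quadraticBasis hF hD hD1 hθ e hf 1 := by
    have h2 : (f : F) ≠ 0 := by exact_mod_cast hf
    simp only [quadraticBasis_zero, quadraticBasis_one, Algebra.smul_def, eq_ratCast]
    push_cast
    field_simp
    ring
  rw [h]
  ext i
  fin_cases i <;> simp [-quadraticBasis_zero, -quadraticBasis_one]

include hF hD hD1 hθ in
theorem exists_eq_add_mul (x : F) : ∃ p q : ℚ, x = p + q * θ := by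
  let b := quadraticBasis hF hD hD1 hθ 0 one_ne_zero
  refine ⟨b.repr x 0, b.repr x 1, ?_⟩
  have := b.sum_repr x
  simp only [Fin.sum_univ_two, Algebra.smul_def, eq_ratCast, b, quadraticBasis_zero,
    quadraticBasis_one, mul_one, Rat.cast_zero, zero_add, Rat.cast_one, one_mul] at this
  exact this.symm

include hF hD hD1 hθ in
theorem leftMulMatrix_add_mul (p q : ℚ) :
    Algebra.leftMulMatrix (quadraticBasis hF hD hD1 hθ 0 one_ne_zero) (p + q * θ) =
      !![p, q * D; q, p] := by
  ext i j
  rw [Algebra.leftMulMatrix_eq_repr_mul]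
  have h1 : (p + q * θ : F) * θ = ((q * D : ℚ) : F) + p * θ := by
    push_cast
    linear_combination (q : F) * hθ
  fin_cases j
  · simp only [Fin.zero_eta, quadraticBasis_zero, mul_one, quadraticBasis_repr]
    fin_cases i <;> simp
  · simp only [Fin.mk_one, quadraticBasis_one, Rat.cast_zero, zero_add, Rat.cast_one, one_mul, h1,
      quadraticBasis_repr]
    fin_cases i <;> simp

include hF hD hD1 hθ in
theorem trace_add_mul (p q : ℚ) : Algebra.trace ℚ F (p + q * θ) = 2 * p := by
  rw [Algebra.trace_eq_matrix_trace (quadraticBasis hF hD hD1 hθ 0 one_ne_zero),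
    leftMulMatrix_add_mul]
  simp [Matrix.trace_fin_two]
  ring

include hF hD hD1 hθ in
theorem norm_add_mul (p q : ℚ) : Algebra.norm ℚ (p + q * θ : F) = p ^ 2 - D * q ^ 2 := by
  rw [Algebra.norm_eq_matrix_det (quadraticBasis hF hD hD1 hθ 0 one_ne_zero),
    leftMulMatrix_add_mul, Matrix.det_fin_two_of]
  ring

include hF hD hD1 hθ in
-- P is the trace and N the norm. They make D(2q)² an integer, and since D is squarefree, 2q has no
-- denominator.
theorem exists_int_of_isIntegral_add_mul {p q : ℚ} (h : IsIntegral ℤ (p + q * θ : F)) :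
    ∃ P Q N : ℤ, 2 * p = P ∧ 2 * q = Q ∧ P ^ 2 - D * Q ^ 2 = 4 * N := by
  obtain ⟨P, hP⟩ := IsIntegrallyClosed.isIntegral_iff.mp (Algebra.isIntegral_trace (L := ℚ) h)
  obtain ⟨N, hN⟩ := IsIntegrallyClosed.isIntegral_iff.mp (Algebra.isIntegral_norm ℚ h)
  rw [trace_add_mul hF hD hD1 hθ] at hP
  rw [norm_add_mul hF hD hD1 hθ] at hN
  simp only [eq_intCast] at hP hN
  have hQ : (D : ℚ) * (2 * q) ^ 2 = ((P ^ 2 - 4 * N : ℤ) : ℚ) := by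
    push_cast
    rw [hP, hN]
    ring
  obtain ⟨Q, hQ'⟩ := Rat.exists_int_of_squarefree_mul_sq hD hQ
  refine ⟨P, Q, N, hP.symm, hQ', ?_⟩
  rw [hQ'] at hQ
  have : D * Q ^ 2 = P ^ 2 - 4 * N := by exact_mod_cast hQ
  linarith

include hF hD hD1 hθ in
-- The transition matrices to and from an integral basis are both integral, so the discriminant may
-- be computed as the determinant of the trace form on 1, e + fθ. The two parameters cover both 1, θ
-- and 1, (1 + θ)/2.
theorem discr_eq_of_forall_isIntegral (e : ℚ) {f : ℚ} (hf : f ≠ 0)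
    (hint : IsIntegral ℤ (e + f * θ : F))
    (h : ∀ p q : ℚ, IsIntegral ℤ (p + q * θ : F) → ∃ m n : ℤ, p - q * e / f = m ∧ q / f = n) :
    (NumberField.discr F : ℚ) = 4 * f ^ 2 * D := by
  rw [NumberField.coe_discr, ← Algebra.discr_eq_discr_of_toMatrix_coeff_isIntegral F
    (b := quadraticBasis hF hD hD1 hθ e hf) (b' := NumberField.integralBasis F)]
  · have h11 : (1 : F) * 1 = ((1 : ℚ) : F) + (0 : ℚ) * θ := by simp
    have h12 : (1 : F) * (e + f * θ) = e + f * θ := by simp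
    have h21 : (e + f * θ) * (1 : F) = e + f * θ := by simp
    have h22 : (e + f * θ) * (e + f * θ : F) =
        ((e ^ 2 + f ^ 2 * D : ℚ) : F) + ((2 * e * f : ℚ) : F) * θ := by
      push_cast
      linear_combination (f : F) ^ 2 * hθ
    rw [Algebra.discr_def, Matrix.det_fin_two]
    simp only [Algebra.traceMatrix_apply, Algebra.traceForm_apply, quadraticBasis_zero,
      quadraticBasis_one]
    rw [h11, h12, h21, h22]
    simp only [trace_add_mul hF hD hD1 hθ]
    ring
  · intro i j
    obtain ⟨p, q, hpq⟩ := exists_eq_add_mul hF hD hD1 hθ (NumberField.integralBasis F j)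
    have hi : IsIntegral ℤ (p + q * θ : F) := by
      rw [← hpq, NumberField.integralBasis_apply]
      exact NumberField.RingOfIntegers.isIntegral_coe _
    obtain ⟨m, n, hm, hn⟩ := h p q hi
    rw [Module.Basis.toMatrix_apply, hpq, quadraticBasis_repr, hm, hn]
    fin_cases i
    · exact isIntegral_algebraMap (x := m)
    · exact isIntegral_algebraMap (x := n)
  · intro i j
    have hj : IsIntegral ℤ (quadraticBasis hF hD hD1 hθ e hf j) := by
      fin_cases j
      · simpa using isIntegral_one
      · simpa using hint
    rw [Module.Basis.toMatrix_apply]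
    have := NumberField.integralBasis_repr_apply F ⟨_, hj⟩ i
    change (NumberField.integralBasis F).repr (quadraticBasis hF hD hD1 hθ e hf j) i = _ at this
    rw [this]
    exact isIntegral_algebraMap

include hF hD hD1 hθ in
/-- The discriminant of the quadratic field `ℚ(√D)`, for `D` squarefree. -/
theorem discr_eq_ite_of_sq_eq_squarefree :
    NumberField.discr F = if D % 4 = 1 then D else 4 * D := by
  have hDθ : IsIntegral ℤ (θ ^ 2) := by
    rw [hθ]; exact isIntegral_algebraMap (x := D)
  have hθi : IsIntegral ℤ θ := IsIntegral.of_pow two_pos hDθ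
  have hD4 : D % 4 ≠ 0 := by
    intro h
    have := hD 2 (by omega)
    simp [Int.isUnit_iff] at this
  split_ifs with h4
  · have key := discr_eq_of_forall_isIntegral hF hD hD1 hθ (1 / 2) (f := 1 / 2) (by norm_num) ?_ ?_
    · have : (NumberField.discr F : ℚ) = D := by rw [key]; ring
      exact_mod_cast this
    · obtain ⟨c, hc⟩ : ∃ c, D = 4 * c + 1 := ⟨D / 4, by omega⟩
      refine ⟨Polynomial.X ^ 2 - Polynomial.X - Polynomial.C c, ?_, ?_⟩
      · rw [sub_sub]
        exact Polynomial.monic_X_pow_sub (by compute_degree; norm_num)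
      · simp only [Polynomial.eval₂_sub, Polynomial.eval₂_X_pow, Polynomial.eval₂_X,
          Polynomial.eval₂_C]
        rw [hc] at hθ
        rw [algebraMap_int_eq, eq_intCast]
        push_cast at hθ ⊢
        linear_combination (1 / 4 : F) * hθ
    · intro p q hpq
      obtain ⟨P, Q, N, hP, hQ, hN⟩ := exists_int_of_isIntegral_add_mul hF hD hD1 hθ hpq
      -- P - Q and P + Q have the same parity and an even product.
      have hpar : (P - Q) % 2 = 0 := by
        obtain ⟨c, hc⟩ : ∃ c, D = 4 * c + 1 := ⟨D / 4, by omega⟩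
        have h1 : (P - Q) * (P + Q) = 4 * (N + c * Q ^ 2) := by rw [hc] at hN; linear_combination hN
        rcases Int.emod_two_eq_zero_or_one (P - Q) with h | h
        · exact h
        · have h2 : (P + Q) % 2 = 1 := by omega
          have := Int.mul_emod (P - Q) (P + Q) 2
          rw [h, h2, h1] at this
          omega
      refine ⟨(P - Q) / 2, Q, ?_, ?_⟩
      · have : (((P - Q) / 2 * 2 : ℤ) : ℚ) = ((P - Q : ℤ) : ℚ) := by
          congr 1; omega
        push_cast at this
        rw [← hP, ← hQ] at this
        linarith
      · rw [← hQ]; ring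
  · have key := discr_eq_of_forall_isIntegral hF hD hD1 hθ 0 one_ne_zero ?_ ?_
    · have : (NumberField.discr F : ℚ) = (4 * D : ℤ) := by rw [key]; push_cast; ring
      exact_mod_cast this
    · simpa using hθi
    · intro p q hpq
      obtain ⟨P, Q, N, hP, hQ, hN⟩ := exists_int_of_isIntegral_add_mul hF hD hD1 hθ hpq
      have hpar : P % 2 = 0 ∧ Q % 2 = 0 := by
        have h1 : (P ^ 2 - D * Q ^ 2) % 4 = 0 := by omega
        have hD23 : D % 4 = 2 ∨ D % 4 = 3 := by omega
        rcases Int.even_or_odd' P with ⟨a, rfl | rfl⟩ <;>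
          rcases Int.even_or_odd' Q with ⟨b, rfl | rfl⟩
        · omega
        · exfalso
          have : (2 * a) ^ 2 - D * (2 * b + 1) ^ 2 = 4 * (a ^ 2 - D * (b ^ 2 + b)) - D := by ring
          omega
        · exfalso
          have : (2 * a + 1) ^ 2 - D * (2 * b) ^ 2 = 4 * (a ^ 2 + a - D * b ^ 2) + 1 := by ring
          omega
        · exfalso
          have : (2 * a + 1) ^ 2 - D * (2 * b + 1) ^ 2 =
            4 * (a ^ 2 + a - D * (b ^ 2 + b)) + 1 - D := by ring
          omega
      refine ⟨P / 2, Q / 2, ?_, ?_⟩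
      · have : ((P / 2 * 2 : ℤ) : ℚ) = (P : ℚ) := by
          congr 1; omega
        push_cast at this
        rw [← hP] at this
        linarith
      · have : ((Q / 2 * 2 : ℤ) : ℚ) = (Q : ℚ) := by
          congr 1; omega
        push_cast at this
        rw [← hQ] at this
        linarith

end QuadraticField

/-- Genus theory yields δ ≡ 1 mod 4, so this case is enough. -/
theorem isQuadraticDiscriminant_of_squarefree {D : ℤ} (hD : Squarefree D) (hD1 : D ≠ 1)
    (h4 : D % 4 = 1) : IsQuadraticDiscriminant D := by
  have : Fact (∀ r : ℚ, r ^ 2 ≠ (D : ℚ) + 0 * r) :=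
    ⟨fun r => by simpa using Rat.sq_ne_squarefree hD hD1 r⟩
  have hfin : Module.finrank ℚ (QuadraticAlgebra ℚ (D : ℚ) 0) = 2 :=
    QuadraticAlgebra.finrank_eq_two _ _
  have hnf : NumberField (QuadraticAlgebra ℚ (D : ℚ) 0) := { }
  refine ⟨QuadraticAlgebra ℚ (D : ℚ) 0, inferInstance, hnf, ?_, ?_⟩
  · convert hfin
  · rw [discr_eq_ite_of_sq_eq_squarefree (D := D) (θ := ⟨0, 1⟩) _ hD hD1 _, if_pos h4]
    · convert hfin
    · ext <;> simp [sq]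

/-! ### Square roots of integers at places above 2 -/

section DyadicValuation

variable {U : Type*} [Field U] (w : Valuation U ℤᵐ⁰)

/-- Exponents of squares are even; the ramification arguments at 2 and at p end in this
contradiction. -/
theorem WithZero.sq_ne_exp_neg_one (g : ℤᵐ⁰) : g ^ 2 ≠ exp (-1 : ℤ) := by
  intro h
  have := congrArg log h
  rw [log_pow, log_exp] at this
  simp at this
  omega

theorem WithZero.eq_exp_neg_one_of_sq {g : ℤᵐ⁰} (h : g ^ 2 = exp (-2 : ℤ)) :
    g = exp (-1 : ℤ) := by
  have hg : g ≠ 0 := by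
    rintro rfl
    simp at h
    exact exp_ne_zero h.symm
  have := congrArg log h
  rw [log_pow, log_exp] at this
  rw [← exp_log hg]
  congr 1
  simp at this
  omega

theorem WithZero.eq_one_of_sq {g : ℤᵐ⁰} (h : g ^ 2 = 1) : g = 1 :=
  (pow_eq_one_iff.mp h).resolve_right two_ne_zero

theorem Valuation.map_intCast_le_one (n : ℤ) : w (n : U) ≤ 1 := by
  induction n using Int.induction_on with
  | zero => simp
  | succ i hi => push_cast at hi ⊢; exact (w.map_add _ _).trans (max_le hi (by simp))
  | pred i hi => push_cast at hi ⊢; exact (w.map_sub _ _).trans (max_le hi (by simp))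

theorem Valuation.map_odd_eq_one (h2 : w 2 < 1) {n : ℤ} (hn : Odd n) : w (n : U) = 1 := by
  obtain ⟨q, rfl⟩ := hn
  have : w (2 * (q : U)) < 1 := by
    rw [map_mul]
    exact mul_lt_one_of_lt_of_le h2 (w.map_intCast_le_one q)
  push_cast
  rw [add_comm]
  exact w.map_one_add_of_lt this

variable {w} {s t : U} {r m : ℤ}

theorem Valuation.map_eq_one_of_sq_odd (h2 : w 2 < 1) (hs : s ^ 2 = (r : U)) (hr : Odd r) :
    w s = 1 := by
  apply WithZero.eq_one_of_sq
  rw [← map_pow, hs, w.map_odd_eq_one h2 hr]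

/-- For r = 4q + 3 one has (s + 1)² = 2(s + 2(q + 1)), and the second factor is a unit. -/
theorem Valuation.map_add_one_sq (h2 : w 2 < 1) (hs : s ^ 2 = (r : U)) (hr : r % 4 = 3) :
    w (s + 1) ^ 2 = w 2 := by
  have hs1 := w.map_eq_one_of_sq_odd h2 hs (Int.odd_iff.mpr (by omega))
  obtain ⟨q, rfl⟩ : ∃ q, r = 4 * q + 3 := ⟨r / 4, by omega⟩
  have h : (s + 1) ^ 2 = 2 * (s + 2 * ((q + 1 : ℤ) : U)) := by
    push_cast at hs ⊢
    linear_combination hs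
  have hlt : w (2 * ((q + 1 : ℤ) : U)) < w s := by
    rw [map_mul, hs1]
    exact mul_lt_one_of_lt_of_le h2 (w.map_intCast_le_one _)
  rw [← map_pow, h, map_mul, w.map_add_eq_of_lt_left hlt, hs1, mul_one]

theorem Valuation.map_sq_of_two_mul_odd (h2 : w 2 < 1) (ht : t ^ 2 = (m : U)) (hm : m % 4 = 2) :
    w t ^ 2 = w 2 := by
  obtain ⟨j, rfl⟩ : ∃ j, m = 2 * j := ⟨m / 2, by omega⟩
  rw [← map_pow, ht]
  push_cast
  rw [map_mul, w.map_odd_eq_one h2 (Int.odd_iff.mpr (by omega)), mul_one]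

/-- If `2` is a uniformizer, then a square root of an integer `r ≡ 2, 3 mod 4` does not exist. -/
theorem Valuation.emod_four_of_sq_of_map_two (h2 : w 2 = exp (-1 : ℤ)) (hs : s ^ 2 = (r : U)) :
    r % 4 ≠ 2 ∧ r % 4 ≠ 3 := by
  have h2' : w 2 < 1 := by rw [h2, ← exp_zero, exp_lt_exp]; norm_num
  constructor <;> intro h
  · exact WithZero.sq_ne_exp_neg_one _ ((w.map_sq_of_two_mul_odd h2' hs h).trans h2)
  · exact WithZero.sq_ne_exp_neg_one _ ((w.map_add_one_sq h2' hs h).trans h2)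

/-- If `2` has absolute ramification index `2`, then square roots of an integer `r ≡ 3 mod 4` and
of an integer `m ≡ 2 mod 4` do not coexist. -/
theorem Valuation.false_of_sq_of_sq_of_map_two (h2 : w 2 = exp (-2 : ℤ)) (hs : s ^ 2 = (r : U))
    (hr : r % 4 = 3) (ht : t ^ 2 = (m : U)) (hm : m % 4 = 2) : False := by
  have h2' : w 2 < 1 := by rw [h2, ← exp_zero, exp_lt_exp]; norm_num
  have hs1 := w.map_eq_one_of_sq_odd h2' hs (Int.odd_iff.mpr (by omega))
  have hsπ := WithZero.eq_exp_neg_one_of_sq ((w.map_add_one_sq h2' hs hr).trans h2)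
  have htπ := WithZero.eq_exp_neg_one_of_sq ((w.map_sq_of_two_mul_odd h2' ht hm).trans h2)
  have hs0 : s + 1 ≠ 0 := by
    intro h
    rw [h, map_zero] at hsπ
    exact exp_ne_zero hsπ.symm
  have hlt : exp (-2 : ℤ) < exp (-1 : ℤ) := by rw [exp_lt_exp]; norm_num
  -- Both t and s + 1 have value `exp (-1)`, so y is a unit. Below, (y - 1)²s turns out to be -(s -
  -- 1) plus terms of smaller value, so the square of y - 1 has odd exponent.
  set y := t / (s + 1) with hy
  have hy1 : w y = 1 := by rw [hy, map_div₀, htπ, hsπ, div_self exp_ne_zero]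
  obtain ⟨q, rfl⟩ : ∃ q, r = 4 * q + 3 := ⟨r / 4, by omega⟩
  obtain ⟨j, rfl⟩ : ∃ j, m = 2 * (2 * j + 1) := ⟨m / 4, by omega⟩
  have h20 : (2 : U) ≠ 0 := by
    intro h
    rw [h, map_zero] at h2
    exact exp_ne_zero h2.symm
  have hrel : y ^ 2 * (s + 2 * ((q + 1 : ℤ) : U)) = ((2 * j + 1 : ℤ) : U) := by
    have h1 : (s + 1) ^ 2 = 2 * (s + 2 * ((q + 1 : ℤ) : U)) := by
      push_cast at hs ⊢
      linear_combination hs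
    have h3 : y ^ 2 * (s + 1) ^ 2 = t ^ 2 := by rw [hy]; field_simp
    rw [h1, ht] at h3
    push_cast at h3 ⊢
    apply mul_left_cancel₀ h20
    linear_combination h3
  have htwo : ∀ z : U, w z ≤ 1 → w (2 * z) ≤ exp (-2 : ℤ) := fun z hz => by
    rw [map_mul, h2]
    exact mul_le_of_le_one_right' hz
  have hym : w (y - 1) ≤ 1 := (w.map_sub _ _).trans (by simp [hy1])
  have hsm : w (s - 1) = exp (-1 : ℤ) := by
    have : s - 1 = (s + 1) - 2 := by ring
    rw [this, w.map_sub_eq_of_lt_left (by rw [h2, hsπ]; exact hlt), hsπ]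
  have hbound : w (2 * ((j : U) - y ^ 2 * (q + 1 : ℤ))) ≤ exp (-2 : ℤ) := by
    apply htwo
    refine (w.map_sub _ _).trans (max_le (w.map_intCast_le_one j) ?_)
    rw [map_mul, map_pow, hy1, one_pow, one_mul]
    exact w.map_intCast_le_one _
  have hbound' : w (2 * ((y - 1) * s)) ≤ exp (-2 : ℤ) := by
    apply htwo
    rw [map_mul, hs1, mul_one]
    exact hym
  have hmain : (y - 1) ^ 2 * s =
      2 * ((j : U) - y ^ 2 * (q + 1 : ℤ)) - 2 * ((y - 1) * s) - (s - 1) := by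
    push_cast at hrel ⊢
    linear_combination hrel
  have hfin : w ((y - 1) ^ 2 * s) = exp (-1 : ℤ) := by
    rw [hmain, w.map_sub_eq_of_lt_right, hsm]
    rw [hsm]
    exact lt_of_le_of_lt ((w.map_sub _ _).trans (max_le hbound hbound')) hlt
  rw [map_mul, hs1, mul_one, map_pow] at hfin
  exact WithZero.sq_ne_exp_neg_one _ hfin

end DyadicValuation

/-! ### Inertia groups and the unramified part of L / k -/

section UnramifiedPart

variable (k L : Type*) [Field k] [Field L] [Algebra k L]

/-- The elements of `L` which are fixed by all inertia groups of `L / k`. -/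
noncomputable def unramifiedPart : IntermediateField k L :=
  ⨅ P : MaximalSpectrum (𝓞 L), FixedPoints.intermediateField (P.asIdeal.inertia Gal(L/k))

variable {k L}

theorem mem_unramifiedPart_iff {x : L} : x ∈ unramifiedPart k L ↔
    ∀ P : Ideal (𝓞 L), P.IsMaximal → ∀ j ∈ P.inertia Gal(L/k), j x = x := by
  rw [unramifiedPart, ← SetLike.mem_coe, IntermediateField.coe_iInf, Set.mem_iInter]
  constructor
  · intro h P hP j hj
    exact h ⟨P, hP⟩ ⟨j, hj⟩
  · intro h P j
    exact h P.asIdeal P.isMaximal j j.2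

variable [NumberField k] [NumberField L]

theorem perfectField_residueField (p : Ideal (𝓞 k)) [p.IsPrime] (hp : p ≠ ⊥) :
    PerfectField p.ResidueField := by
  have := Ideal.IsPrime.isMaximal ‹_› hp
  have := Ring.HasFiniteQuotients.finiteQuotient hp
  infer_instance

theorem inertia_eq_bot_of_ramificationIdx_eq_one [IsGalois k L] (p : Ideal (𝓞 k)) [p.IsPrime]
    (hp : p ≠ ⊥) (P : Ideal (𝓞 L)) [P.IsPrime] [P.LiesOver p]
    (hP : P.ramificationIdx (𝓞 k) = 1) : P.inertia Gal(L/k) = ⊥ := by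
  have := perfectField_residueField p hp
  have h := Ideal.card_inertia_eq_ramificationIdxIn (G := Gal(L/k)) p P
  rw [Ideal.ramificationIdxIn_eq_ramificationIdx p P Gal(L/k), hP] at h
  exact Subgroup.eq_bot_of_card_eq _ h

/-- Restriction to M sends inertia at P into inertia at P ∩ M, which is trivial. -/
theorem algebraMap_mem_unramifiedPart {M : Type*} [Field M] [Algebra k M] [FiniteDimensional k M]
    [Algebra M L] [IsScalarTower k M L] [IsGalois k M] (hM : IsUnramifiedExtension k M) (y : M) :
    algebraMap M L y ∈ unramifiedPart k L := by
  have : CharZero M := charZero_of_injective_algebraMap (algebraMap k M).injective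
  have : FiniteDimensional ℚ M := Module.Finite.trans k M
  have : NumberField M := { }
  rw [mem_unramifiedPart_iff]
  intro P hP j hj
  let Q := P.under (𝓞 M)
  let p := P.under (𝓞 k)
  have hpQ : Q.LiesOver p := ⟨by simp only [Q, p, Ideal.under_under]⟩
  have hPbot : P ≠ ⊥ := Ring.ne_bot_of_isMaximal_of_not_isField hP
    (NumberField.RingOfIntegers.not_isField L)
  have hp : p ≠ ⊥ := Ideal.IsIntegral.comap_ne_bot (𝓞 k) hPbot
  have hram := (hM p inferInstance hp).ramificationIdx_eq_one hpQ
  have hbot := inertia_eq_bot_of_ramificationIdx_eq_one p hp Q hram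
  have hres : j.restrictNormal M ∈ Q.inertia Gal(M/k) := by
    intro x
    have hx : j • algebraMap (𝓞 M) (𝓞 L) x - algebraMap (𝓞 M) (𝓞 L) x ∈ P := hj _
    change algebraMap (𝓞 M) (𝓞 L) _ ∈ P
    convert hx using 1
    apply NumberField.RingOfIntegers.ext
    have := AlgEquiv.restrictNormal_commutes j M (x : M)
    rw [map_sub]
    change algebraMap M L ((j.restrictNormal M) (x : M)) - algebraMap M L x = _
    rw [this]
    rfl
  rw [hbot, Subgroup.mem_bot] at hres
  have := AlgEquiv.restrictNormal_commutes j M y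
  rw [hres] at this
  exact this.symm

/-- Since k / ℚ is normal, conjugation by τ preserves Gal(L/k), and it carries the inertia group of
P to that of τ⁻¹P. -/
theorem map_mem_unramifiedPart [IsGalois ℚ k] (τ : L ≃ₐ[ℚ] L) {x : L}
    (hx : x ∈ unramifiedPart k L) : τ x ∈ unramifiedPart k L := by
  rw [mem_unramifiedPart_iff] at hx ⊢
  intro P hP j hj
  let σ := τ.restrictNormal k
  have hσ : ∀ y : k, τ (algebraMap k L y) = algebraMap k L (σ y) := fun y =>
    (AlgEquiv.restrictNormal_commutes τ k y).symm
  let j' : Gal(L/k) := AlgEquiv.ofRingEquiv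
    (f := ((τ : L ≃+* L).trans (j : L ≃+* L)).trans (τ.symm : L ≃+* L)) (by
    intro y
    change τ.symm (j (τ (algebraMap k L y))) = _
    rw [hσ, j.commutes, ← hσ, AlgEquiv.symm_apply_apply])
  let f : 𝓞 L →+* 𝓞 L := NumberField.RingOfIntegers.mapRingHom (τ : L →+* L)
  have hf : Function.Surjective f := by
    intro y
    refine ⟨NumberField.RingOfIntegers.mapRingHom (τ.symm : L →+* L) y, ?_⟩
    apply NumberField.RingOfIntegers.ext
    exact τ.apply_symm_apply _
  have hmax : (P.comap f).IsMaximal := Ideal.comap_isMaximal_of_surjective f hf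
  have hj' : j' ∈ (P.comap f).inertia Gal(L/k) := by
    intro y
    have : j • f y - f y ∈ P := hj _
    change f _ ∈ P
    convert this using 1
    apply NumberField.RingOfIntegers.ext
    rw [map_sub]
    change τ (τ.symm (j (τ y))) - τ y = j (τ y) - τ y
    rw [AlgEquiv.apply_symm_apply]
  have := hx _ hmax j' hj'
  change τ.symm (j (τ x)) = x at this
  rw [← τ.apply_symm_apply (j (τ x)), this]

/-- The valuation comes from the inertia field F of a single prime P above v. The inertia group of P
is the same over k and over F, so P has the same ramification index over both, and P ∩ F has index 1
over v. -/
theorem exists_valuation_unramifiedPart [IsGalois k L] (v : HeightOneSpectrum (𝓞 k)) :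
    ∃ w : Valuation (unramifiedPart k L) ℤᵐ⁰,
      ∀ x : k, w (algebraMap k (unramifiedPart k L) x) = v.valuation k x := by
  obtain ⟨P, hP, hPv⟩ := Ideal.exists_maximal_ideal_liesOver_of_isIntegral (S := 𝓞 L) v.asIdeal
  let J := P.inertia Gal(L/k)
  let F : IntermediateField k L := FixedPoints.intermediateField J
  have hUF : unramifiedPart k L ≤ F := by
    intro x hx j
    exact mem_unramifiedPart_iff.mp hx P hP j j.2
  let Q := P.under (𝓞 F)
  have hQ : Q.LiesOver v.asIdeal := ⟨by
    simp only [Q, Ideal.under_under]; exact hPv.over⟩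
  have hQbot : Q ≠ ⊥ := Ideal.ne_bot_of_liesOver_of_ne_bot v.ne_bot Q
  have hgal : IsGaloisGroup J F L := IsGaloisGroup.subgroup Gal(L/k) k L J
  have hgal' : IsGaloisGroup J (𝓞 F) (𝓞 L) := .of_isFractionRing _ _ _ F L
  have hpf := perfectField_residueField v.asIdeal v.ne_bot
  have hpf' := perfectField_residueField Q hQbot
  have h1 := Ideal.card_inertia_eq_ramificationIdxIn (G := Gal(L/k)) v.asIdeal P
  have h2 := Ideal.card_inertia_eq_ramificationIdxIn (G := J) Q P
  rw [Ideal.ramificationIdxIn_eq_ramificationIdx v.asIdeal P Gal(L/k)] at h1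
  rw [Ideal.ramificationIdxIn_eq_ramificationIdx Q P J] at h2
  have h3 : P.inertia J = ⊤ := by
    rw [eq_top_iff]
    intro j _
    exact j.2
  have h4 : P.ramificationIdx (𝓞 k) = P.ramificationIdx (𝓞 F) := by
    rw [← h1, ← h2, h3, Subgroup.card_top]
  have h5 := Ideal.ramificationIdx_tower (R := 𝓞 k) Q P
  have hpos : 0 < P.ramificationIdx (𝓞 F) := Ideal.ramificationIdx_pos ..
  have h6 : Q.ramificationIdx (𝓞 k) = 1 := by
    rw [h4] at h5
    exact (right_eq_mul₀ hpos.ne').mp h5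
  let W : HeightOneSpectrum (𝓞 F) := ⟨Q, inferInstance, hQbot⟩
  have hW : W.asIdeal.LiesOver v.asIdeal := hQ
  refine ⟨(W.valuation F).comap (IntermediateField.inclusion hUF : unramifiedPart k L →+* F), ?_⟩
  intro x
  have := HeightOneSpectrum.valuation_liesOver F v W x
  rw [Ideal.ramificationIdx'_eq_ramificationIdx _ _ v.ne_bot, h6, pow_one] at this
  rw [this]
  rfl

end UnramifiedPart

/-! ### Square ideals, squarefree divisors and a descent modulo 4 -/

theorem Ideal.exists_eq_sq_of_even_multiplicity {R : Type*} [CommRing R] [IsDedekindDomain R]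
    {I : Ideal R} (hI : I ≠ ⊥)
    (h : ∀ v : HeightOneSpectrum R, Even (multiplicity v.asIdeal I)) :
    ∃ J : Ideal R, I = J ^ 2 := by
  classical
  obtain ⟨t, ht⟩ := Multiset.exists_smul_of_dvd_count
    (UniqueFactorizationMonoid.normalizedFactors I) (k := 2) (by
      intro P hP
      have hprime := UniqueFactorizationMonoid.prime_of_normalized_factor P hP
      have heven := h ⟨P, Ideal.isPrime_of_prime hprime, hprime.ne_zero⟩
      have := UniqueFactorizationMonoid.emultiplicity_eq_count_normalizedFactors
        hprime.irreducible hI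
      rw [normalize_eq] at this
      rw [multiplicity_eq_of_emultiplicity_eq_some this] at heven
      exact heven.two_dvd)
  refine ⟨t.prod, ?_⟩
  rw [← Multiset.prod_nsmul, ← ht, Ideal.prod_normalizedFactors_eq_self hI]

theorem Int.dvd_of_squarefree_of_forall_prime {r D : ℤ} (hr : Squarefree r)
    (h : ∀ p : ℕ, p.Prime → (p : ℤ) ∣ r → (p : ℤ) ∣ D) : r ∣ D := by
  rw [← Int.natAbs_dvd_natAbs,
    ← Nat.prod_primeFactors_of_squarefree (Int.squarefree_natAbs.mpr hr)]
  refine Finset.prod_primes_dvd _ (fun p hp => ?_) fun p hp => ?_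
  · exact (Nat.prime_of_mem_primeFactors hp).prime
  · exact Int.natCast_dvd.mp
      (h p (Nat.prime_of_mem_primeFactors hp)
        (Int.natCast_dvd.mpr (Nat.dvd_of_mem_primeFactors hp)))

/-- If z is odd, a sum of two squares would be 3 mod 4; if z is even, so are x and y, and one
descends. -/
theorem Int.eq_zero_of_sq_add_sq_eq_mul_sq {D : ℤ} (hD : D % 4 = 3) {x y z : ℤ}
    (h : x ^ 2 + y ^ 2 = D * z ^ 2) : z = 0 := by
  induction hn : z.natAbs using Nat.strong_induction_on generalizing x y z with
  | _ n ih =>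
    by_contra hz
    rcases Int.even_or_odd' z with ⟨c, rfl | rfl⟩
    · have hxy : ∃ a b, x = 2 * a ∧ y = 2 * b := by
        have h4 : (x ^ 2 + y ^ 2) % 4 = 0 := by
          rw [h, show D * (2 * c) ^ 2 = 4 * (D * c ^ 2) by ring]; omega
        rcases Int.even_or_odd' x with ⟨a, rfl | rfl⟩ <;>
          rcases Int.even_or_odd' y with ⟨b, rfl | rfl⟩ <;> ring_nf at h4
        · exact ⟨a, b, rfl, rfl⟩
        all_goals omega
      obtain ⟨a, b, rfl, rfl⟩ := hxy
      have h' : a ^ 2 + b ^ 2 = D * c ^ 2 := by linarith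
      have := ih c.natAbs (by omega) h' rfl
      omega
    · have h4 : (x ^ 2 + y ^ 2) % 4 = 3 := by
        rw [h, show D * (2 * c + 1) ^ 2 = 4 * (D * (c ^ 2 + c)) + D by ring]; omega
      rcases Int.even_or_odd' x with ⟨a, rfl | rfl⟩ <;>
        rcases Int.even_or_odd' y with ⟨b, rfl | rfl⟩ <;> ring_nf at h4 <;> omega

theorem Rat.eq_zero_of_sq_add_sq_eq_mul_sq {D : ℤ} (hD : D % 4 = 3) {x y z : ℚ}
    (h : x ^ 2 + y ^ 2 = D * z ^ 2) : z = 0 := by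
  have hx : (x.den : ℚ) ≠ 0 := by exact_mod_cast x.den_ne_zero
  have hy : (y.den : ℚ) ≠ 0 := by exact_mod_cast y.den_ne_zero
  have hz : (z.den : ℚ) ≠ 0 := by exact_mod_cast z.den_ne_zero
  have key : (x.num * y.den * z.den) ^ 2 + (y.num * x.den * z.den) ^ 2 =
      D * (z.num * x.den * y.den) ^ 2 := by
    rw [← Rat.num_div_den x, ← Rat.num_div_den y, ← Rat.num_div_den z] at h
    field_simp at h
    have h' : ((x.num : ℚ) * y.den * z.den) ^ 2 + (y.num * x.den * z.den) ^ 2 =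
      D * (z.num * x.den * y.den) ^ 2 := by linear_combination h
    exact_mod_cast h'
  have := Int.eq_zero_of_sq_add_sq_eq_mul_sq hD key
  simpa using this

/-! ### Genus theory: square roots of elements of k in an unramified extension -/

section UnramifiedQuadratic

variable {k U : Type*} [Field k] [NumberField k] [Field U] [Algebra k U]
  (hU : ∀ v : HeightOneSpectrum (𝓞 k), ∃ w : Valuation U ℤᵐ⁰,
    ∀ x : k, w (algebraMap k U x) = v.valuation k x)

theorem Ideal.ramificationIdx_le_finrank_rat (P : Ideal (𝓞 k)) [P.IsPrime] :
    P.ramificationIdx ℤ ≤ Module.finrank ℚ k := by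
  by_cases hP : P = ⊥
  · subst hP
    have h1 : (⊥ : Ideal (𝓞 k)).ramificationIdx ℤ = 1 :=
      Ideal.ramificationIdx_eq_one_iff.mpr Algebra.isUnramifiedAt_bot
    rw [h1]
    exact Module.finrank_pos
  · have := Ideal.IsPrime.isMaximal ‹P.IsPrime› hP
    let p := P.under ℤ
    have : p.IsMaximal := Ideal.IsMaximal.under ℤ P
    have : Finite (p.primesOver (𝓞 k)) :=
      (IsDedekindDomain.primesOver_finite p (𝓞 k)).to_subtype
    let _ := Fintype.ofFinite (p.primesOver (𝓞 k))
    rw [← NumberField.RingOfIntegers.rank, ← Ideal.sum_ramification_inertia_eq_finrank p (𝓞 k)]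
    let P' : p.primesOver (𝓞 k) := ⟨P, inferInstance, ⟨rfl⟩⟩
    refine le_trans ?_ (Finset.single_le_sum (f := fun q : p.primesOver (𝓞 k) =>
      (q : Ideal (𝓞 k)).ramificationIdx ℤ * (q : Ideal (𝓞 k)).inertiaDeg ℤ)
      (fun _ _ => Nat.zero_le _) (Finset.mem_univ P'))
    exact Nat.le_mul_of_pos_right _ (Ideal.inertiaDeg_pos ..)

include hU in
-- Here e is the ramification index over ℤ of a prime of k above p; passing to U does not enlarge
-- it.
theorem exists_valuation_natCast {p : ℕ} (hp : p.Prime) :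
    ∃ (w : Valuation U ℤᵐ⁰) (e : ℕ), w (p : U) = exp (-(e : ℤ)) ∧ 1 ≤ e ∧
      e ≤ Module.finrank ℚ k ∧ (¬ (p : ℤ) ∣ NumberField.discr k → e = 1) := by
  have hpZ : Prime (p : ℤ) := Nat.prime_iff_prime_int.mp hp
  let v₀ : HeightOneSpectrum ℤ := ⟨Ideal.span {(p : ℤ)},
    (Ideal.span_singleton_prime hpZ.ne_zero).mpr hpZ, by simpa using hpZ.ne_zero⟩
  have := v₀.isMaximal
  obtain ⟨P, hP, hPv⟩ := Ideal.exists_maximal_ideal_liesOver_of_isIntegral (S := 𝓞 k) v₀.asIdeal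
  have hPbot : P ≠ ⊥ := Ideal.ne_bot_of_liesOver_of_ne_bot v₀.ne_bot P
  let v : HeightOneSpectrum (𝓞 k) := ⟨P, inferInstance, hPbot⟩
  have hv : v.asIdeal.LiesOver v₀.asIdeal := hPv
  obtain ⟨w, hw⟩ := hU v
  refine ⟨w, P.ramificationIdx ℤ, ?_, Ideal.ramificationIdx_pos ..,
    P.ramificationIdx_le_finrank_rat, fun h => ?_⟩
  · have h1 := HeightOneSpectrum.valuation_liesOver k v₀ v (p : ℚ)
    rw [Ideal.ramificationIdx'_eq_ramificationIdx _ _ v₀.ne_bot] at h1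
    have h2 : v₀.valuation ℚ (p : ℚ) = exp (-1 : ℤ) := by
      have := HeightOneSpectrum.valuation_of_algebraMap (K := ℚ) v₀ (p : ℤ)
      rw [HeightOneSpectrum.intValuation_singleton v₀ hpZ.ne_zero rfl] at this
      simpa using this
    have h3 := hw (p : k)
    rw [map_natCast] at h3
    rw [map_natCast (algebraMap ℚ k)] at h1
    rw [h3, ← h1, h2, ← exp_nsmul]
    simp
    rfl
  · exact ((NumberField.not_dvd_discr_iff_isUnramifiedIn k (𝓞 k) hpZ).mp h).ramificationIdx_eq_one
      hPv

include hU in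
-- All valuations of a = u² are even, so (a) = J² and |N(a)| = N(J)².
theorem exists_norm_eq_sq_of_integer {a : 𝓞 k} (ha : a ≠ 0) {u : U}
    (hu : u ^ 2 = algebraMap k U a) :
    ∃ n : ℚ, n ≠ 0 ∧ (Algebra.norm ℚ (a : k) = n ^ 2 ∨ Algebra.norm ℚ (a : k) = -n ^ 2) := by
  have hI : Ideal.span {a} ≠ ⊥ := by simpa using ha
  obtain ⟨J, hJ⟩ := Ideal.exists_eq_sq_of_even_multiplicity hI (fun v => by
    obtain ⟨w, hw⟩ := hU v
    have h1 := hw a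
    rw [← hu, map_pow, HeightOneSpectrum.valuation_of_algebraMap,
      HeightOneSpectrum.intValuation_eq_exp_neg_multiplicity _ ha] at h1
    have h2 := congrArg log h1
    rw [log_pow, log_exp] at h2
    have h3 : ((multiplicity v.asIdeal (Ideal.span {a}) : ℕ) : ℤ) = 2 * (-log (w u)) := by
      simp only [nsmul_eq_mul, Nat.cast_ofNat] at h2
      linarith
    have : Even ((multiplicity v.asIdeal (Ideal.span {a}) : ℕ) : ℤ) := by
      rw [h3]; exact even_two_mul _
    exact_mod_cast this)
  have hN := Ideal.absNorm_span_singleton a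
  rw [hJ, map_pow] at hN
  have hne : (Algebra.norm ℤ a) ≠ 0 := by simpa [Algebra.norm_eq_zero_iff] using ha
  refine ⟨(Ideal.absNorm J : ℚ), ?_, ?_⟩
  · intro h0
    have : Ideal.absNorm J = 0 := by exact_mod_cast h0
    rw [this] at hN
    simp at hN
    exact ha (by simpa using hN.symm)
  · rw [← Algebra.coe_norm_int]
    rcases Int.natAbs_eq (Algebra.norm ℤ a) with h | h
    · left; rw [h, ← hN]; push_cast; ring
    · right; rw [h, ← hN]; push_cast; ring

include hU in
theorem exists_norm_eq_sq {a : k} (ha : a ≠ 0) {u : U} (hu : u ^ 2 = algebraMap k U a) :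
    ∃ n : ℚ, n ≠ 0 ∧ (Algebra.norm ℚ a = n ^ 2 ∨ Algebra.norm ℚ a = -n ^ 2) := by
  obtain ⟨b, c, hc, rfl⟩ := IsFractionRing.div_surjective (A := 𝓞 k) a
  have hc0 : algebraMap (𝓞 k) k c ≠ 0 := by
    simpa using nonZeroDivisors.ne_zero hc
  have hcN : Algebra.norm ℚ (algebraMap (𝓞 k) k c) ≠ 0 := Algebra.norm_ne_zero_iff.mpr hc0
  have hb0 : algebraMap (𝓞 k) k b ≠ 0 := fun h => ha (by rw [h, zero_div])
  -- The integer bc is b/c times the square c².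
  obtain ⟨n, hn, h⟩ := exists_norm_eq_sq_of_integer hU (a := b * c)
    (mul_ne_zero (by simpa using hb0) (nonZeroDivisors.ne_zero hc))
    (u := u * algebraMap k U (algebraMap (𝓞 k) k c)) (by
      rw [mul_pow, hu, ← map_pow, ← map_mul]
      congr 1
      change _ = algebraMap (𝓞 k) k (b * c)
      rw [map_mul]
      field_simp)
  refine ⟨n / Algebra.norm ℚ (algebraMap (𝓞 k) k c), by positivity, ?_⟩
  change Algebra.norm ℚ (algebraMap (𝓞 k) k (b * c)) = _ ∨
    Algebra.norm ℚ (algebraMap (𝓞 k) k (b * c)) = _ at h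
  rw [map_mul, map_mul] at h
  have hdiv : Algebra.norm ℚ (algebraMap (𝓞 k) k b / algebraMap (𝓞 k) k c) =
      Algebra.norm ℚ (algebraMap (𝓞 k) k b) / Algebra.norm ℚ (algebraMap (𝓞 k) k c) := by
    rw [eq_div_iff hcN, ← map_mul, div_mul_cancel₀ _ hc0]
  rw [hdiv]
  refine h.imp (fun h => ?_) fun h => ?_
  · field_simp; linear_combination h
  · field_simp; linear_combination h

/-- Hilbert 90 made explicit: if z has conjugate z' and zz' = n², then (z + n)² = z(z + z' + 2n), a
rational multiple of z. When either side vanishes, z is itself rational. -/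
theorem exists_eq_squarefree_mul_sq_of_norm_eq_sq (hk : Module.finrank ℚ k = 2) {a : k}
    (ha : a ≠ 0) {n : ℚ} (hn : n ≠ 0) (h : Algebra.norm ℚ a = n ^ 2) :
    ∃ (r : ℤ) (c : k), Squarefree r ∧ c ≠ 0 ∧ a = r * c ^ 2 := by
  obtain ⟨D, θ, hD, hD1, hθ⟩ := exists_sq_eq_squarefree_of_finrank_eq_two hk
  obtain ⟨p, q, rfl⟩ := exists_eq_add_mul hk hD hD1 hθ a
  rw [norm_add_mul hk hD hD1 hθ] at h
  have hrat : ∀ e : ℚ, e ≠ 0 → ∀ c : k, c ≠ 0 → (p + q * θ : k) * c ^ 2 = e →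
      ∃ (r : ℤ) (c : k), Squarefree r ∧ c ≠ 0 ∧ (p + q * θ : k) = r * c ^ 2 := by
    intro e he c hc hec
    obtain ⟨r, c', hr, hc', hrc⟩ := Rat.exists_squarefree_mul_sq he
    refine ⟨r, c' / c, hr, div_ne_zero (by exact_mod_cast hc') hc, ?_⟩
    rw [hrc] at hec
    push_cast at hec
    field_simp
    exact hec
  have hz : (p + q * θ : k) * (p - q * θ) = n ^ 2 := by
    have h' : (p : k) ^ 2 - D * q ^ 2 = n ^ 2 := by exact_mod_cast h
    linear_combination h' - (q : k) ^ 2 * hθ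
  by_cases hpn : p + n = 0
  · have hq : q = 0 := by
      have hp : p = -n := by linarith
      have hD0 : (D : ℚ) ≠ 0 := by exact_mod_cast hD.ne_zero
      have : (D : ℚ) * q ^ 2 = 0 := by rw [hp] at h; linarith
      simpa [hD0] using this
    subst hq
    refine hrat p ?_ 1 one_ne_zero (by simp)
    rintro rfl
    simp at ha
  · have hpn' : (p + n : k) ≠ 0 := by exact_mod_cast hpn
    by_cases han : (p + q * θ + n : k) = 0
    · refine hrat (-n) (neg_ne_zero.mpr hn) 1 one_ne_zero ?_
      push_cast
      linear_combination han
    · refine hrat ((2 * (p + n))⁻¹) (inv_ne_zero (mul_ne_zero two_ne_zero hpn))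
        ((p + q * θ + n)⁻¹) (inv_ne_zero han) ?_
      have hsq : (p + q * θ : k) * (2 * (p + n)) = (p + q * θ + n) ^ 2 := by
        linear_combination hz
      push_cast
      rw [inv_pow, ← div_eq_mul_inv, div_eq_iff (pow_ne_zero 2 han), ← hsq]
      field_simp

include hU in
-- If p were unramified in k, then r = pm with m prime to p would have value `exp (-1)`, yet it is
-- the square of t.
theorem dvd_discr_of_sq_eq_squarefree {r : ℤ} (hr : Squarefree r) {t : U} (ht : t ^ 2 = (r : U))
    {p : ℕ} (hp : p.Prime) (hpr : (p : ℤ) ∣ r) : (p : ℤ) ∣ NumberField.discr k := by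
  by_contra hpd
  obtain ⟨w, e, hw, -, -, he⟩ := exists_valuation_natCast hU hp
  obtain rfl := he hpd
  obtain ⟨m, rfl⟩ := hpr
  have hpm : IsCoprime (p : ℤ) m := by
    refine (Nat.prime_iff_prime_int.mp hp).coprime_iff_not_dvd.mpr ?_
    rintro ⟨m', rfl⟩
    have := hr p ⟨m', by ring⟩
    exact (Nat.prime_iff_prime_int.mp hp).not_isUnit this
  have hwp : w (p : U) < 1 := by
    rw [hw, ← exp_zero, exp_lt_exp]; norm_num
  have hwm : w (m : U) = 1 := by
    refine le_antisymm (w.map_intCast_le_one m) (not_lt.mp fun hlt => ?_)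
    obtain ⟨x, y, hxy⟩ := hpm
    have hxy' : (x : U) * p + y * m = 1 := by exact_mod_cast congrArg (Int.cast (R := U)) hxy
    have h1 : w ((x : U) * p + y * m) < 1 := by
      refine w.map_add_lt ?_ ?_
      · rw [map_mul, mul_comm]
        exact mul_lt_one_of_lt_of_le hwp (w.map_intCast_le_one x)
      · rw [map_mul, mul_comm]
        exact mul_lt_one_of_lt_of_le hlt (w.map_intCast_le_one y)
    rw [hxy', map_one] at h1
    exact lt_irrefl _ h1
  refine WithZero.sq_ne_exp_neg_one (w t) ?_
  rw [← map_pow, ht]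
  push_cast
  rw [map_mul, hwm, hw, mul_one]
  simp

variable (hk : Module.finrank ℚ k = 2) {D : ℤ} (hD : Squarefree D) (hD1 : D ≠ 1) {θ : k}
  (hθ : θ ^ 2 = D)

theorem Int.emod_four_ne_zero_of_squarefree {r : ℤ} (hr : Squarefree r) : r % 4 ≠ 0 := by
  intro h
  have := hr 2 (by omega)
  simp [Int.isUnit_iff] at this

include hU hk in
theorem exists_valuation_two : ∃ w : Valuation U ℤᵐ⁰, w 2 = exp (-1 : ℤ) ∨ w 2 = exp (-2 : ℤ) := by
  obtain ⟨w, e, hw, h1, h2, -⟩ := exists_valuation_natCast hU Nat.prime_two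
  rw [hk] at h2
  refine ⟨w, ?_⟩
  interval_cases e
  · left; simpa using hw
  · right; simpa using hw

include hU hk in
theorem false_of_sq_emod_four {r m : ℤ} {s t : U} (hs : s ^ 2 = (r : U)) (hr : r % 4 = 3)
    (ht : t ^ 2 = (m : U)) (hm : m % 4 = 2) : False := by
  obtain ⟨w, hw | hw⟩ := exists_valuation_two hU hk
  · exact (w.emod_four_of_sq_of_map_two hw hs).2 hr
  · exact w.false_of_sq_of_sq_of_map_two hw hs hr ht hm

include hU hk hD hD1 hθ in
theorem emod_four_of_sq {r : ℤ} {s : U} (hs : s ^ 2 = (r : U)) (h4 : D % 4 = 1) :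
    r % 4 ≠ 2 ∧ r % 4 ≠ 3 := by
  have hd := discr_eq_ite_of_sq_eq_squarefree hk hD hD1 hθ
  rw [if_pos h4] at hd
  obtain ⟨w, e, hw, -, -, he⟩ := exists_valuation_natCast hU Nat.prime_two
  obtain rfl := he (by rw [hd]; push_cast; omega)
  exact w.emod_four_of_sq_of_map_two (by simpa using hw) hs

include hU hk hD hD1 hθ in
-- The relation excludes D ≡ 3 mod 4. As -1 ≡ 3 mod 4, its square root conflicts with 2 being
-- unramified if D ≡ 1, and with √D if D ≡ 2.
theorem neg_one_not_sq_of_sq_add_sq {x n y : ℚ} (hn : n ≠ 0) (h : x ^ 2 + n ^ 2 = D * y ^ 2)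
    (i : U) (hi : i ^ 2 = -1) : False := by
  have hi' : i ^ 2 = ((-1 : ℤ) : U) := by simpa using hi
  have h3 : D % 4 ≠ 3 := by
    intro h3
    have hy := Rat.eq_zero_of_sq_add_sq_eq_mul_sq h3 h
    rw [hy] at h
    have : 0 < n ^ 2 := by positivity
    nlinarith [sq_nonneg x]
  have h0 := Int.emod_four_ne_zero_of_squarefree hD
  have hθU : (algebraMap k U θ) ^ 2 = (D : U) := by rw [← map_pow, hθ, map_intCast]
  rcases (by omega : D % 4 = 1 ∨ D % 4 = 2) with h4 | h4
  · exact (emod_four_of_sq hU hk hD hD1 hθ hi' h4).2 (by norm_num)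
  · exact false_of_sq_emod_four hU hk hi' (by norm_num) hθU h4

include hU hk hD hD1 hθ in
/-- A quadratic extension `k(√r) / k`, with `r` rational, that is unramified at all finite primes
is generated by the square root of a discriminant `δ ≡ 1 mod 4` dividing that of `k`. -/
theorem exists_discriminant_of_sq_eq_squarefree {r : ℤ} (hr : Squarefree r) {t : U}
    (ht : t ^ 2 = (r : U)) :
    ∃ (δ : ℤ) (c : k), Squarefree δ ∧ δ % 4 = 1 ∧ δ ∣ NumberField.discr k ∧ c ≠ 0 ∧
      (r : k) = δ * c ^ 2 := by
  have hd := discr_eq_ite_of_sq_eq_squarefree hk hD hD1 hθ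
  have hDd : D ∣ NumberField.discr k := by
    rw [hd]; split_ifs
    · exact dvd_rfl
    · exact Dvd.intro_left _ rfl
  have hθU : (algebraMap k U θ) ^ 2 = (D : U) := by rw [← map_pow, hθ, map_intCast]
  have hodd : ∀ p : ℕ, p.Prime → p ≠ 2 → (p : ℤ) ∣ r → (p : ℤ) ∣ D := by
    intro p hp hp2 hpr
    have h1 := dvd_discr_of_sq_eq_squarefree hU hr ht hp hpr
    rw [hd] at h1
    split_ifs at h1
    · exact h1
    · refine ((Nat.prime_iff_prime_int.mp hp).dvd_mul.mp h1).resolve_left fun h => hp2 ?_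
      have h' : p ∣ 2 ^ 2 := by exact_mod_cast h
      exact (Nat.prime_dvd_prime_iff_eq hp Nat.prime_two).mp (hp.dvd_of_dvd_pow h')
  have hrD : (2 ∣ r → 2 ∣ D) → r ∣ D := fun h2 =>
    Int.dvd_of_squarefree_of_forall_prime hr fun p hp hpr => by
      by_cases hp2 : p = 2
      · subst hp2; exact h2 hpr
      · exact hodd p hp hp2 hpr
  have h0r := Int.emod_four_ne_zero_of_squarefree hr
  have h0D := Int.emod_four_ne_zero_of_squarefree hD
  have done1 : r % 4 = 1 → ∃ (δ : ℤ) (c : k), Squarefree δ ∧ δ % 4 = 1 ∧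
      δ ∣ NumberField.discr k ∧ c ≠ 0 ∧ (r : k) = δ * c ^ 2 := fun h =>
    ⟨r, 1, hr, h, (hrD (by omega)).trans hDd, one_ne_zero, by simp⟩
  -- Since D = θ² is a square in k, r may be exchanged for e = D/r.
  have done2 : ∀ e : ℤ, D = r * e → e % 4 = 1 → ∃ (δ : ℤ) (c : k), Squarefree δ ∧ δ % 4 = 1 ∧
      δ ∣ NumberField.discr k ∧ c ≠ 0 ∧ (r : k) = δ * c ^ 2 := by
    intro e hDe he
    have hr0 : (r : k) ≠ 0 := by exact_mod_cast hr.ne_zero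
    have hθ0 : θ ≠ 0 := by
      rintro rfl
      have : (D : k) = 0 := by simpa using hθ.symm
      exact hD.ne_zero (by exact_mod_cast this)
    refine ⟨e, r / θ, hD.squarefree_of_dvd (Dvd.intro_left _ hDe.symm), he,
      (Dvd.intro_left _ hDe.symm).trans hDd, div_ne_zero hr0 hθ0, ?_⟩
    rw [div_pow, hθ, hDe]
    have he0 : (e : k) ≠ 0 := by
      have : e ≠ 0 := by omega
      exact_mod_cast this
    push_cast
    field_simp
  rcases (by omega : r % 4 = 1 ∨ r % 4 = 2 ∨ r % 4 = 3) with h1 | h2 | h3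
  · exact done1 h1
  · rcases (by omega : D % 4 = 1 ∨ D % 4 = 2 ∨ D % 4 = 3) with h4 | h4 | h4
    · exact ((emod_four_of_sq hU hk hD hD1 hθ ht h4).1 h2).elim
    · obtain ⟨e, he⟩ := hrD (by omega)
      have he2 : e % 2 = 1 := by
        rcases Int.emod_two_eq_zero_or_one e with h | h
        · obtain ⟨e', rfl⟩ : ∃ e', e = 2 * e' := ⟨e / 2, by omega⟩
          obtain ⟨r', rfl⟩ : ∃ r', r = 2 * r' := ⟨r / 2, by omega⟩
          have : D = 4 * (r' * e') := by rw [he]; ring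
          omega
        · exact h
      rcases (by omega : e % 4 = 1 ∨ e % 4 = 3) with h5 | h5
      · exact done2 e he h5
      -- θ/t is a square root of e ≡ 3, which cannot coexist with the square root θ of D ≡ 2.
      · refine (false_of_sq_emod_four hU hk (s := algebraMap k U θ / t) (r := e) ?_ h5 hθU h4).elim
        have : CharZero U := charZero_of_injective_algebraMap (algebraMap k U).injective
        have hr0 : (r : U) ≠ 0 := by exact_mod_cast hr.ne_zero
        rw [div_pow, hθU, ht, he]
        push_cast
        field_simp
    · exact (false_of_sq_emod_four hU hk hθU h4 ht h2).elim
  · rcases (by omega : D % 4 = 1 ∨ D % 4 = 2 ∨ D % 4 = 3) with h4 | h4 | h4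
    · exact ((emod_four_of_sq hU hk hD hD1 hθ ht h4).2 h3).elim
    · exact (false_of_sq_emod_four hU hk ht h3 hθU h4).elim
    · obtain ⟨e, he⟩ := hrD (by omega)
      refine done2 e he ?_
      have := Int.mul_emod r e 4
      rw [← he, h3, h4] at this
      have he4 := Int.emod_nonneg e (by norm_num : (4 : ℤ) ≠ 0)
      have he4' := Int.emod_lt_of_pos e (by norm_num : (0 : ℤ) < 4)
      interval_cases h : e % 4 <;> omega

include hU hk in
/-- If `k(√a) / k` and its conjugate are unramified at all finite primes, then `a` agrees up to
squares with `1` or with a quadratic discriminant dividing that of `k`. -/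
theorem exists_discriminant_of_sq {a : k} (ha : a ≠ 0)
    (hu : ∀ σ : k ≃ₐ[ℚ] k, ∃ u : U, u ^ 2 = algebraMap k U (σ a)) :
    ∃ (δ : ℤ) (c : k), (δ = 1 ∨ IsQuadraticDiscriminant δ) ∧ δ ∣ NumberField.discr k ∧ c ≠ 0 ∧
      a = δ * c ^ 2 := by
  obtain ⟨D, θ, hD, hD1, hθ⟩ := exists_sq_eq_squarefree_of_finrank_eq_two hk
  obtain ⟨u, hua⟩ := hu 1
  change u ^ 2 = algebraMap k U a at hua
  obtain ⟨n, hn, hN | hN⟩ := exists_norm_eq_sq hU ha hua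
  · obtain ⟨r, c, hr, hc, hrc⟩ := exists_eq_squarefree_mul_sq_of_norm_eq_sq hk ha hn hN
    have hcU : algebraMap k U c ≠ 0 := by simpa using hc
    obtain ⟨δ, c', hδ, hδ4, hδd, hc', hrδ⟩ :=
      exists_discriminant_of_sq_eq_squarefree hU hk hD hD1 hθ hr (t := u / algebraMap k U c) (by
        rw [div_pow, hua, hrc, map_mul, map_pow, map_intCast]
        field_simp)
    refine ⟨δ, c' * c, ?_, hδd, mul_ne_zero hc' hc, by rw [hrc, hrδ]; ring⟩
    by_cases h1 : δ = 1
    · exact Or.inl h1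
    · exact Or.inr (isQuadraticDiscriminant_of_squarefree hδ h1 hδ4)
  · exfalso
    obtain ⟨x, y, rfl⟩ := exists_eq_add_mul hk hD hD1 hθ a
    rw [norm_add_mul hk hD hD1 hθ] at hN
    have : Algebra.IsQuadraticExtension ℚ k := ⟨hk⟩
    obtain ⟨σ, hσ⟩ : ∃ σ : k ≃ₐ[ℚ] k, σ θ = -θ := by
      by_contra! h
      have hcard := IsGalois.card_aut_eq_finrank ℚ k
      have : Subsingleton (k ≃ₐ[ℚ] k) := by
        refine subsingleton_of_forall_eq 1 fun σ => ?_
        have hσ2 : σ θ ^ 2 = θ ^ 2 := by rw [← map_pow, hθ, map_intCast]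
        have hσ : σ θ = θ := (sq_eq_sq_iff_eq_or_eq_neg.mp hσ2).resolve_right (h σ)
        ext z
        obtain ⟨p, q, rfl⟩ := exists_eq_add_mul hk hD hD1 hθ z
        simp [hσ]
      rw [hk, Nat.card_of_subsingleton 1] at hcard
      omega
    obtain ⟨u', hu'⟩ := hu σ
    have hnk : (n : k) ≠ 0 := by exact_mod_cast hn
    -- The norm is a·σ(a) = -n², so uu'/n is a square root of -1.
    refine neg_one_not_sq_of_sq_add_sq hU hk hD hD1 hθ hn (x := x) (y := y) (by linarith)
      (u * u' / algebraMap k U (n : k)) ?_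
    rw [div_pow, mul_pow, hua, hu', ← map_mul, ← map_pow,
      div_eq_iff ((map_ne_zero _).mpr (pow_ne_zero 2 hnk)),
      ← map_one (algebraMap k U), ← map_neg, ← map_mul]
    congr 1
    have hN' : (x : k) ^ 2 - D * y ^ 2 = -n ^ 2 := by exact_mod_cast hN
    simp only [map_add, map_mul, map_ratCast, hσ]
    linear_combination hN' - (y : k) ^ 2 * hθ

end UnramifiedQuadratic

/-! ### The quaternion group and its action on quaternion extensions -/

theorem exists_involution_of_mulEquiv_quaternionGroup {G : Type*} [Group G]
    (e : G ≃* QuaternionGroup 2) : ∃ z : G, z ≠ 1 ∧ z * z = 1 ∧ (∃ σ, σ * σ = z) ∧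
      (∀ σ, σ * σ = 1 → σ = 1 ∨ σ = z) ∧ ∀ σ, σ * σ = 1 ∨ σ * σ = z := by
  have h : (QuaternionGroup.a 2 : QuaternionGroup 2) ≠ 1 ∧
      (QuaternionGroup.a 2 : QuaternionGroup 2) * QuaternionGroup.a 2 = 1 ∧
      (∃ g : QuaternionGroup 2, g * g = QuaternionGroup.a 2) ∧
      (∀ g : QuaternionGroup 2, g * g = 1 → g = 1 ∨ g = QuaternionGroup.a 2) ∧
      ∀ g : QuaternionGroup 2, g * g = 1 ∨ g * g = QuaternionGroup.a 2 := by decide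
  obtain ⟨h1, h2, ⟨g, h3⟩, h4, h5⟩ := h
  refine ⟨e.symm (QuaternionGroup.a 2), by simpa using h1, by rw [← map_mul, h2, map_one],
    ⟨e.symm g, by rw [← map_mul, h3]⟩, fun σ hσ => ?_, fun σ => ?_⟩
  · have := h4 (e σ) (by rw [← map_mul, hσ, map_one])
    simpa [e.eq_symm_apply] using this
  · have := h5 (e σ)
    rw [← map_mul] at this
    refine this.imp (fun h => e.injective (by rw [h, map_one])) fun h => ?_
    rw [e.eq_symm_apply, h]

section QuaternionExtension

variable {k M : Type*} [Field k] [Field M] [Algebra k M]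

theorem IsH8Extension.finrank_eq (hM : IsH8Extension k M) : Module.finrank k M = 8 := by
  obtain ⟨_, _, ⟨e⟩⟩ := hM
  rw [← IsGalois.card_aut_eq_finrank, Nat.card_congr e.toEquiv, Nat.card_eq_fintype_card,
    QuaternionGroup.card]

/-- The group fixing K has order 2, so it is generated by the unique involution z. Any σ outside it
has square z, and therefore commutes with z. -/
theorem IsH8Extension.exists_involution (hM : IsH8Extension k M) (K : IntermediateField k M)
    (hK : Module.finrank k K = 4) : ∃ z : M ≃ₐ[k] M, (∀ x, z x = x ↔ x ∈ K) ∧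
      (∀ x, z (z x) = x) ∧ (∀ (σ : M ≃ₐ[k] M) x, σ (z x) = z (σ x)) ∧
      ∀ σ : M ≃ₐ[k] M, (∀ x ∈ K, σ x = x) ∨ ∀ x, σ (σ x) = z x := by
  have h8 := hM.finrank_eq
  obtain ⟨_, _, ⟨e⟩⟩ := hM
  obtain ⟨z, hz1, hzz, -, hinv, hsq⟩ := exists_involution_of_mulEquiv_quaternionGroup e
  have hcard : Nat.card K.fixingSubgroup = 2 := by
    rw [IsGalois.card_fixingSubgroup_eq_finrank]
    have := Module.finrank_mul_finrank k K M
    rw [hK, h8] at this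
    omega
  have hmem : ∀ σ, σ ∈ K.fixingSubgroup ↔ σ = 1 ∨ σ = z := by
    have hsub : ∀ σ ∈ K.fixingSubgroup, σ = 1 ∨ σ = z := by
      intro σ hσ
      apply hinv
      have := pow_card_eq_one' (x := (⟨σ, hσ⟩ : K.fixingSubgroup))
      rw [hcard, sq] at this
      exact congrArg Subtype.val this
    have hz : z ∈ K.fixingSubgroup := by
      by_contra hz
      have : K.fixingSubgroup = ⊥ := by
        rw [eq_bot_iff]
        intro σ hσ
        rcases hsub σ hσ with rfl | rfl
        · exact Subgroup.one_mem _
        · exact (hz hσ).elim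
      rw [this] at hcard
      simp at hcard
    intro σ
    refine ⟨hsub σ, ?_⟩
    rintro (rfl | rfl)
    · exact Subgroup.one_mem _
    · exact hz
  have hcase : ∀ σ, (σ = 1 ∨ σ = z) ∨ σ * σ = z := fun σ =>
    (hsq σ).imp (hinv σ) id
  refine ⟨z, fun x => ⟨fun hx => ?_, fun hx => ?_⟩, fun x => DFunLike.congr_fun hzz x,
    fun σ x => ?_, fun σ => ?_⟩
  · rw [← IsGalois.fixedField_fixingSubgroup K]
    rintro ⟨σ, hσ⟩
    rcases (hmem σ).mp hσ with rfl | rfl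
    · rfl
    · exact hx
  · exact (IntermediateField.mem_fixingSubgroup_iff K z).mp ((hmem z).mpr (Or.inr rfl)) x hx
  · have : σ * z = z * σ := by
      rcases hcase σ with (rfl | rfl) | h
      · simp
      · rfl
      · rw [← h, mul_assoc]
    exact DFunLike.congr_fun this x
  · rcases hcase σ with h | h
    · left
      exact (IntermediateField.mem_fixingSubgroup_iff K σ).mp ((hmem σ).mpr h)
    · right
      exact DFunLike.congr_fun h

variable {K L : Type*} [Field K] [Algebra k K] [Field L] [Algebra k L]

/-- The action of the automorphisms of an overfield `L` on a quaternion extension `M = K(m)`. -/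
theorem IsH8Extension.exists_involution_of_algHom (hM : IsH8Extension k M)
    (hK : Module.finrank k K = 4) (i : K →ₐ[k] M) (j : M →ₐ[k] L) :
    ∃ z : M ≃ₐ[k] M, (∀ x, z x = x ↔ x ∈ i.range) ∧ (∀ x, z (z x) = x) ∧
      ∀ γ : L ≃ₐ[k] L,
        (∀ x, ∃ y, γ (j (i x)) = j (i y)) ∧ (∀ x, γ (γ (j (i x))) = j (i x)) ∧
        ∀ m, m ≠ 0 → z m = -m → (∃ c, γ (j m) = j (i c) * j m) ∧
          ((∀ x, γ (j (i x)) = j (i x)) → γ (γ (j m)) = j m) ∧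
          ((¬ ∀ x, γ (j (i x)) = j (i x)) → γ (γ (j m)) = -j m) := by
  have hK' : Module.finrank k i.fieldRange = 4 := by
    rw [← hK]
    exact (AlgEquiv.ofInjectiveField i).toLinearEquiv.finrank_eq.symm
  obtain ⟨z, hz, hzz, hcomm, hcase⟩ := hM.exists_involution i.fieldRange hK'
  obtain ⟨_, _, -⟩ := hM
  have hz' : ∀ x, z x = x ↔ ∃ y, i y = x := hz
  refine ⟨z, hz, hzz, fun γ => ?_⟩
  let _ : Algebra M L := j.toRingHom.toAlgebra
  have : IsScalarTower k M L := .of_algebraMap_eq fun x => (j.commutes x).symm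
  let σ := γ.restrictNormal M
  have hσ : ∀ x, γ (j x) = j (σ x) := fun x => (AlgEquiv.restrictNormal_commutes γ M x).symm
  have hfix : (∀ x, γ (j (i x)) = j (i x)) ↔ ∀ x ∈ i.fieldRange, σ x = x := by
    constructor
    · rintro h _ ⟨x, rfl⟩
      exact j.injective ((hσ (i x)).symm.trans (h x))
    · intro h x
      rw [hσ, h (i x) ⟨x, rfl⟩]
  have hzi : ∀ x, z (i x) = i x := fun x => (hz' _).mpr ⟨x, rfl⟩
  refine ⟨fun x => ?_, fun x => ?_, fun m hm hzm => ⟨?_, fun h => ?_, fun h => ?_⟩⟩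
  · obtain ⟨y, hy⟩ := (hz' (σ (i x))).mp (by rw [← hcomm, hzi])
    exact ⟨y, by rw [hσ, hy]⟩
  · rw [hσ, hσ]
    rcases hcase σ with h | h
    · rw [h (i x) ⟨x, rfl⟩, h (i x) ⟨x, rfl⟩]
    · rw [h, hzi]
  -- z negates both σm and m, so it fixes their quotient, which thus lies in K.
  · obtain ⟨c, hc⟩ := (hz' (σ m / m)).mp (by
      rw [map_div₀, ← hcomm, hzm, map_neg, neg_div_neg_eq])
    refine ⟨c, ?_⟩
    rw [hσ, hc, ← map_mul, div_mul_cancel₀ _ hm]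
  · have hsq : σ m ^ 2 = m ^ 2 := by
      rw [← map_pow]
      exact hfix.mp h _ ((hz _).mp (by rw [map_pow, hzm, neg_sq]))
    rw [hσ, hσ]
    rcases sq_eq_sq_iff_eq_or_eq_neg.mp hsq with h1 | h1
    · rw [h1, h1]
    · rw [h1, map_neg, h1, neg_neg]
  · rw [hσ, hσ]
    rcases hcase σ with h1 | h1
    · exact (h (hfix.mpr h1)).elim
    · rw [h1, hzm, map_neg]

end QuaternionExtension

/-- A line over `K` inside a Galois extension `L / k` on which the Galois group acts through
involutions contains an element whose square lies in `k`. -/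
theorem exists_sq_mem_of_involutive_action {k K L : Type*} [Field k] [Field K] [Field L]
    [Algebra k K] [Algebra k L] [FiniteDimensional k L] [IsGalois k L]
    (ψ : K →ₐ[k] L) {w : L}
    (hψ : ∀ (γ : L ≃ₐ[k] L) x, ∃ y, γ (ψ x) = ψ y)
    (hψ2 : ∀ (γ : L ≃ₐ[k] L) x, γ (γ (ψ x)) = ψ x)
    (hγw : ∀ γ : L ≃ₐ[k] L, ∃ c, γ w = ψ c * w) (hw2 : ∀ γ : L ≃ₐ[k] L, γ (γ w) = w) :
    ∃ κ : K, κ ≠ 0 ∧ ∃ a : k, (ψ κ * w) ^ 2 = algebraMap k L a := by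
  have hstab : ∀ (γ : L ≃ₐ[k] L) x, ∃ y, γ (ψ x * w) = ψ y * w := by
    intro γ x
    obtain ⟨y, hy⟩ := hψ γ x
    obtain ⟨c, hc⟩ := hγw γ
    exact ⟨y * c, by rw [map_mul, hy, hc, map_mul, mul_assoc]⟩
  have hinv : ∀ (γ : L ≃ₐ[k] L) x, γ (γ (ψ x * w)) = ψ x * w := by
    intro γ x
    rw [map_mul, map_mul, hψ2, hw2]
  -- A group in which every element acts as an involution acts commutatively.
  have hcomm : ∀ (γ h : L ≃ₐ[k] L) x, γ (h (ψ x * w)) = h (γ (ψ x * w)) := by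
    intro γ h x
    have h1 : h (γ (h (γ (ψ x * w)))) = ψ x * w := hinv (h * γ) x
    obtain ⟨y, hy⟩ := hstab γ x
    obtain ⟨y', hy'⟩ := hstab h y
    obtain ⟨y'', hy''⟩ := hstab γ y'
    rw [hy, hy'] at h1 ⊢
    rw [hy''] at h1
    rw [← h1, hinv, ← hy'', hinv]
  have key : ∀ s : Finset (L ≃ₐ[k] L), ∃ κ : K, κ ≠ 0 ∧
      ∀ γ ∈ s, γ (ψ κ * w) = ψ κ * w ∨ γ (ψ κ * w) = -(ψ κ * w) := by
    classical
    intro s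
    induction s using Finset.induction_on with
    | empty => exact ⟨1, one_ne_zero, by simp⟩
    | insert γ s _ ih =>
      obtain ⟨κ, hκ, hs⟩ := ih
      obtain ⟨y, hy⟩ := hstab γ κ
      -- Either κw is already a (-1)-eigenvector of γ, or κw + γ(κw) is nonzero and fixed by γ; by
      -- commutativity the sum keeps the earlier eigenvalues.
      by_cases h0 : κ + y = 0
      · refine ⟨κ, hκ, ?_⟩
        rw [Finset.forall_mem_insert]
        refine ⟨Or.inr ?_, hs⟩
        rw [hy, eq_neg_of_add_eq_zero_right h0, map_neg, neg_mul]
      · have hsum : ψ (κ + y) * w = ψ κ * w + γ (ψ κ * w) := by rw [hy, map_add, add_mul]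
        refine ⟨κ + y, h0, ?_⟩
        rw [Finset.forall_mem_insert]
        refine ⟨Or.inl ?_, fun h hh => ?_⟩
        · rw [hsum, map_add, hinv, add_comm]
        · rw [hsum, map_add, ← hcomm]
          rcases hs h hh with h1 | h1
          · left; rw [h1]
          · right; rw [h1, map_neg]; ring
  obtain ⟨κ, hκ, h⟩ := key Finset.univ
  refine ⟨κ, hκ, ?_⟩
  obtain ⟨a, ha⟩ := (IsGalois.mem_range_algebraMap_iff_fixed ((ψ κ * w) ^ 2)).mpr (by
    intro γ
    rw [map_pow]
    rcases h γ (Finset.mem_univ _) with h1 | h1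
    · rw [h1]
    · rw [h1, neg_sq])
  exact ⟨a, ha.symm⟩

/-- Normality over ℚ, not merely over k, lets the automorphisms of k lift to L. -/
theorem exists_numberField_isGalois_rat.{u} (E : Type u) [Field E] [NumberField E] :
    ∃ (L : Type u) (_ : Field L) (_ : NumberField L) (_ : Algebra E L), IsGalois ℚ L := by
  let L := IntermediateField.normalClosure ℚ E (AlgebraicClosure E)
  have : Algebra.IsAlgebraic ℚ (AlgebraicClosure E) := Algebra.IsAlgebraic.trans ℚ E _
  have : IsAlgClosure ℚ (AlgebraicClosure E) := ⟨inferInstance, inferInstance⟩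
  have : Normal ℚ (AlgebraicClosure E) := IsAlgClosure.normal ℚ _
  have : FiniteDimensional ℚ L := normalClosure.is_finiteDimensional ℚ E (AlgebraicClosure E)
  have : NumberField L := { }
  have : Normal ℚ L := normalClosure.normal ℚ E (AlgebraicClosure E)
  exact ⟨L, inferInstance, inferInstance, normalClosure.algebra ℚ E (AlgebraicClosure E), { }⟩

theorem algHom_mem_unramifiedPart {k L M : Type*} [Field k] [NumberField k] [Field L]
    [NumberField L] [Algebra k L] [Field M] [Algebra k M] [FiniteDimensional k M] [IsGalois k M]
    (hM : IsUnramifiedExtension k M) (f : M →ₐ[k] L) (y : M) : f y ∈ unramifiedPart k L := by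
  let _ : Algebra M L := f.toRingHom.toAlgebra
  have : IsScalarTower k M L := .of_algebraMap_eq fun x => (f.commutes x).symm
  exact algebraMap_mem_unramifiedPart hM y

/-- If `u` lies in an extension of `k` unramified at all finite primes and `u ^ 2 = a` is in `k`,
then `a` agrees up to squares with `1` or with a quadratic discriminant dividing that of `k`. -/
theorem exists_discriminant_of_mem_unramifiedPart {k L : Type*} [Field k] [NumberField k]
    [Field L] [NumberField L] [Algebra k L] [IsGalois ℚ L] (hk : Module.finrank ℚ k = 2)
    {a : k} (ha : a ≠ 0) {u : L} (hu : u ∈ unramifiedPart k L) (hua : u ^ 2 = algebraMap k L a) :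
    ∃ (δ : ℤ) (c : k), (δ = 1 ∨ IsQuadraticDiscriminant δ) ∧ δ ∣ NumberField.discr k ∧ c ≠ 0 ∧
      a = δ * c ^ 2 := by
  have : IsGalois k L := IsGalois.tower_top_of_isGalois ℚ k L
  have : Algebra.IsQuadraticExtension ℚ k := ⟨hk⟩
  refine exists_discriminant_of_sq (U := unramifiedPart k L) exists_valuation_unramifiedPart hk ha
    fun σ => ?_
  let τ : L ≃ₐ[ℚ] L := σ.liftNormal L
  refine ⟨⟨τ u, map_mem_unramifiedPart τ hu⟩, Subtype.ext ?_⟩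
  change τ u ^ 2 = algebraMap k L (σ a)
  rw [← map_pow, hua, AlgEquiv.liftNormal_commutes]

/-! ### Comparing two unramified quaternion extensions over K -/

section QuaternionExtensionPair

variable {k K M N : Type*} [Field k] [Field K] [Algebra k K]
  [Field M] [Algebra k M] [Field N] [Algebra k N]

/-- N is the sum of the ±1-eigenspaces of z: the first is K, the second is spanned over K by any
nonzero y - zy. -/
theorem IsH8Extension.exists_generator [CharZero k] (hN : IsH8Extension k N)
    (i : K →ₐ[k] N) {z : N ≃ₐ[k] N} (hz : ∀ x, z x = x ↔ x ∈ i.range) (hzz : ∀ x, z (z x) = x)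
    (hK : Module.finrank k K = 4) :
    ∃ n : N, n ≠ 0 ∧ z n = -n ∧ (∃ ν, n ^ 2 = i ν) ∧ ∀ x, ∃ α β, x = i α + i β * n := by
  have : CharZero N := charZero_of_injective_algebraMap (algebraMap k N).injective
  have hz' : ∀ x, z x = x → ∃ y, i y = x := fun x => (hz x).mp
  obtain ⟨y, hy⟩ : ∃ y, z y ≠ y := by
    by_contra! h
    have hbij : Function.Bijective i := ⟨i.injective, fun x => hz' x (h x)⟩
    have := (AlgEquiv.ofBijective i hbij).toLinearEquiv.finrank_eq
    rw [hK, hN.finrank_eq] at this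
    omega
  have hn : y - z y ≠ 0 := sub_ne_zero.mpr hy.symm
  have hzn : z (y - z y) = -(y - z y) := by rw [map_sub, hzz]; ring
  refine ⟨y - z y, hn, hzn, ?_, fun x => ?_⟩
  · obtain ⟨ν, hν⟩ := hz' ((y - z y) ^ 2) (by rw [map_pow, hzn, neg_sq])
    exact ⟨ν, hν.symm⟩
  · obtain ⟨α, hα⟩ := hz' ((x + z x) / 2) (by
      rw [map_div₀, map_add, hzz, map_ofNat, add_comm])
    obtain ⟨β, hβ⟩ := hz' ((x - z x) / (2 * (y - z y))) (by
      rw [map_div₀, map_mul, hzn, map_sub, hzz, map_ofNat, ← neg_sub x, mul_neg, neg_div_neg_eq])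
    refine ⟨α, β, ?_⟩
    rw [hα, hβ]
    field_simp
    ring

theorem exists_discriminant_of_isH8Extension [NumberField k] (hk : Module.finrank ℚ k = 2)
    (hK : Module.finrank k K = 4) (hMH : IsH8Extension k M) (hMu : IsUnramifiedExtension k M)
    (hNH : IsH8Extension k N) (hNu : IsUnramifiedExtension k N) {L : Type*} [Field L]
    [NumberField L] [IsGalois ℚ L] [Algebra k L] (iM : K →ₐ[k] M) (iN : K →ₐ[k] N)
    (jM : M →ₐ[k] L) (jN : N →ₐ[k] L) (hcomp : ∀ x, jM (iM x) = jN (iN x))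
    {m : M} {μ : K} (hm : m ^ 2 = iM μ) (hmK : m ∉ iM.range) :
    ∃ (n : N) (ν κ : K) (δ : ℤ) (c : k), n ≠ 0 ∧ n ^ 2 = iN ν ∧
      (∀ x, ∃ α β, x = iN α + iN β * n) ∧ κ ≠ 0 ∧ c ≠ 0 ∧
      (δ = 1 ∨ IsQuadraticDiscriminant δ) ∧ δ ∣ NumberField.discr k ∧
      κ ^ 2 * μ * ν = algebraMap k K (δ * c ^ 2) := by
  have : IsGalois k L := IsGalois.tower_top_of_isGalois ℚ k L
  obtain ⟨zM, hzM, -, hM⟩ := hMH.exists_involution_of_algHom hK iM jM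
  obtain ⟨zN, hzN, hzzN, hN⟩ := hNH.exists_involution_of_algHom hK iN jN
  obtain ⟨n, hn0, hzn, ⟨ν, hν⟩, hgen⟩ := hNH.exists_generator iN hzN hzzN hK
  have hm0 : m ≠ 0 := by
    rintro rfl
    exact hmK ⟨0, map_zero iM⟩
  have hzm : zM m = -m := by
    have hsq : zM m ^ 2 = m ^ 2 := by
      rw [← map_pow, hm]
      exact (hzM _).mpr ⟨μ, rfl⟩
    exact (sq_eq_sq_iff_eq_or_eq_neg.mp hsq).resolve_left fun h => hmK ((hzM m).mp h)
  have hw0 : jM m * jN n ≠ 0 := mul_ne_zero (by simpa using hm0) (by simpa using hn0)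
  obtain ⟨κ, hκ, a, ha⟩ := exists_sq_mem_of_involutive_action (jM.comp iM) (w := jM m * jN n)
    (fun γ => (hM γ).1) (fun γ => (hM γ).2.1)
    (fun γ => by
      obtain ⟨c, hc⟩ := ((hM γ).2.2 m hm0 hzm).1
      obtain ⟨c', hc'⟩ := ((hN γ).2.2 n hn0 hzn).1
      refine ⟨c * c', ?_⟩
      rw [map_mul, map_mul, hc, hc', ← hcomp, AlgHom.comp_apply, AlgHom.comp_apply]
      ring)
    (fun γ => by
      obtain ⟨-, h1, h2⟩ := (hM γ).2.2 m hm0 hzm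
      obtain ⟨-, h3, h4⟩ := (hN γ).2.2 n hn0 hzn
      simp only [← hcomp] at h3 h4
      rw [map_mul, map_mul]
      by_cases h : ∀ x, γ (jM (iM x)) = jM (iM x)
      · rw [h1 h, h3 h]
      -- The two signs depend only on the action of γ on K, so they cancel in the product.
      · rw [h2 h, h4 h, neg_mul_neg])
  have hκL : jM (iM κ) ≠ 0 := by simpa using hκ
  have ha0 : a ≠ 0 := by
    rintro rfl
    rw [map_zero] at ha
    exact mul_ne_zero hκL hw0 (pow_eq_zero_iff two_ne_zero |>.mp ha)
  have hmem : (jM.comp iM) κ * (jM m * jN n) ∈ unramifiedPart k L := by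
    obtain ⟨_, _, -⟩ := hMH
    obtain ⟨_, _, -⟩ := hNH
    exact mul_mem (algHom_mem_unramifiedPart hMu jM _) (mul_mem
      (algHom_mem_unramifiedPart hMu jM _) (algHom_mem_unramifiedPart hNu jN _))
  obtain ⟨δ, c, hδ, hδd, hc, hac⟩ := exists_discriminant_of_mem_unramifiedPart hk ha0 hmem ha
  refine ⟨n, ν, κ, δ, c, hn0, hν, hgen, hκ, hc, hδ, hδd, (jM.comp iM).injective ?_⟩
  change (jM.comp iM) (κ ^ 2 * μ * ν) = (jM.comp iM) (algebraMap k K _)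
  rw [← hac, AlgHom.commutes, ← ha, map_mul, map_mul, map_pow, mul_pow, mul_pow, ← map_pow jM,
    ← map_pow jN, hm, hν, ← hcomp]
  simp only [AlgHom.comp_apply]
  ring

end QuaternionExtensionPair

/-! ### Adjoining a square root inside Ω -/

section IntermediateFields

variable {k Ω : Type*} [Field k] [Field Ω] [Algebra k Ω]

theorem mem_adjoinOver_self (K : IntermediateField k Ω) (r : Ω) : r ∈ adjoinOver K r :=
  IntermediateField.mem_adjoin_simple_self K r

theorem le_adjoinOver (K : IntermediateField k Ω) (r : Ω) : K ≤ adjoinOver K r := fun x hx =>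
  IntermediateField.algebraMap_mem (IntermediateField.adjoin K {r}) ⟨x, hx⟩

theorem adjoinOver_le {K N : IntermediateField k Ω} {r : Ω} (hKN : K ≤ N) (hr : r ∈ N) :
    adjoinOver K r ≤ N := by
  intro x hx
  let N' : IntermediateField K Ω := IntermediateField.extendScalars hKN
  have : IntermediateField.adjoin K {r} ≤ N' := by
    rw [IntermediateField.adjoin_simple_le_iff]
    exact hr
  exact this hx

/-- The base of a quaternion extension `K(√μ)`, where `K` is generated by square roots. -/
theorem finrank_eq_four_of_isH8Extension_adjoinOver {S : Set Ω} {K : IntermediateField k Ω}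
    (hS : ∀ s ∈ S, ∃ a : k, s ^ 2 = algebraMap k Ω a) (hK : K = IntermediateField.adjoin k S)
    {μ : K} {m : Ω} (hm : m ^ 2 = (μ : Ω)) (hM : IsH8Extension k (adjoinOver K m)) :
    Module.finrank k K = 4 ∧ m ∉ K := by
  have h8 := hM.finrank_eq
  obtain ⟨_, _, ⟨e⟩⟩ := hM
  obtain ⟨z, hz1, -, ⟨σ, hσ⟩, -, -⟩ := exists_involution_of_mulEquiv_quaternionGroup e
  have hKM := le_adjoinOver K m
  have hzK : ∀ x : K,
      z (IntermediateField.inclusion hKM x) = IntermediateField.inclusion hKM x := by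
    have : (z : adjoinOver K m →ₐ[k] adjoinOver K m).comp (IntermediateField.inclusion hKM) =
        IntermediateField.inclusion hKM := by
      refine IntermediateField.algHom_ext_of_eq_adjoin k hK fun s hs => ?_
      obtain ⟨a, ha⟩ := hS s hs
      let t : adjoinOver K m := IntermediateField.inclusion hKM
        ⟨s, hK.ge (IntermediateField.subset_adjoin _ _ hs)⟩
      change z t = t
      have ht : t ^ 2 = algebraMap k _ a := Subtype.ext ha
      have hσt : σ t ^ 2 = t ^ 2 := by rw [← map_pow, ht, AlgEquiv.commutes]
      rw [← hσ, AlgEquiv.mul_apply]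
      -- σ maps each generating square root to ± itself, so z = σ² fixes K.
      rcases sq_eq_sq_iff_eq_or_eq_neg.mp hσt with h | h
      · rw [h, h]
      · rw [h, map_neg, h, neg_neg]
    exact fun x => DFunLike.congr_fun this x
  have hmK : m ∉ K := by
    intro hmK
    apply hz1
    ext x
    have hx : (x : Ω) ∈ K := adjoinOver_le le_rfl hmK x.2
    exact congrArg Subtype.val (hzK ⟨x, hx⟩)
  refine ⟨?_, hmK⟩
  have hint : IsIntegral K m := by
    refine IsIntegral.of_pow two_pos ?_
    rw [hm]
    exact isIntegral_algebraMap (x := μ)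
  have hle : Module.finrank K (IntermediateField.adjoin K {m}) ≤ 2 := by
    rw [IntermediateField.adjoin.finrank hint]
    have hdeg : (Polynomial.X ^ 2 - Polynomial.C μ).natDegree = 2 :=
      Polynomial.natDegree_X_pow_sub_C
    rw [← hdeg]
    refine Polynomial.natDegree_le_of_dvd (minpoly.dvd K m ?_)
      (Polynomial.monic_X_pow_sub_C μ two_ne_zero).ne_zero
    simp only [map_sub, map_pow, Polynomial.aeval_X, Polynomial.aeval_C, hm]
    exact sub_self _
  have hne : Module.finrank K (IntermediateField.adjoin K {m}) ≠ 1 := by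
    intro h1
    rw [IntermediateField.finrank_adjoin_simple_eq_one_iff, IntermediateField.mem_bot] at h1
    obtain ⟨x, hx⟩ := h1
    exact hmK (hx ▸ x.2)
  have hmul : Module.finrank k K * Module.finrank K (IntermediateField.adjoin K {m}) = 8 :=
    (Module.finrank_mul_finrank k K (IntermediateField.adjoin K {m})).trans h8
  interval_cases h : Module.finrank K (IntermediateField.adjoin K {m}) <;> omega

end IntermediateFields

theorem mainTheorem6 {k Ω : Type*} [Field k] [NumberField k] [Field Ω] [Algebra k Ω]
    (hk : Module.finrank ℚ k = 2)
    (d₁ d₂ d₃ : ℤ)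
    (hd₁ : IsQuadraticDiscriminant d₁) (hd₂ : IsQuadraticDiscriminant d₂)
    (hd₃ : IsQuadraticDiscriminant d₃)
    (hd : NumberField.discr k = d₁ * d₂ * d₃)
    (s₁ s₂ s₃ : Ω) (hs₁ : s₁ ^ 2 = (d₁ : Ω)) (hs₂ : s₂ ^ 2 = (d₂ : Ω)) (hs₃ : s₃ ^ 2 = (d₃ : Ω))
    (K M N : IntermediateField k Ω)
    (hK : K = IntermediateField.adjoin k {s₁, s₂, s₃})
    (μ : K) (m : Ω) (hm : m ^ 2 = (μ : Ω))
    (hM : M = adjoinOver K m)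
    (hMH : IsH8Extension k M) (hMu : IsUnramifiedExtension k M)
    (hNH : IsH8Extension k N) (hNu : IsUnramifiedExtension k N)
    (hKN : K ≤ N) :
    ∃ δ : ℤ, IsQuadraticDiscriminant δ ∧ δ ∣ NumberField.discr k ∧
      ∃ n : Ω, n ^ 2 = (δ : Ω) * (μ : Ω) ∧ N = adjoinOver K n := by
  subst hM
  have hKM := le_adjoinOver K m
  have hS : ∀ s ∈ ({s₁, s₂, s₃} : Set Ω), ∃ a : k, s ^ 2 = algebraMap k Ω a := by
    rintro s (rfl | rfl | rfl)
    · exact ⟨d₁, by rw [hs₁, map_intCast]⟩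
    · exact ⟨d₂, by rw [hs₂, map_intCast]⟩
    · exact ⟨d₃, by rw [hs₃, map_intCast]⟩
  obtain ⟨hK4, hmK⟩ := finrank_eq_four_of_isH8Extension_adjoinOver hS hK hm hMH
  -- Ω may be infinite over k; the Galois closure is taken of the compositum of M and N.
  let E : IntermediateField k Ω := adjoinOver K m ⊔ N
  have := hMH.1
  have := hNH.1
  have : FiniteDimensional k E := IntermediateField.finiteDimensional_sup _ _
  have : CharZero Ω := charZero_of_injective_algebraMap (algebraMap k Ω).injective
  have : FiniteDimensional ℚ E := Module.Finite.trans k E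
  have : NumberField E := { }
  obtain ⟨L, _, _, _, _⟩ := exists_numberField_isGalois_rat E
  let _ : Algebra k L := ((algebraMap E L).comp (algebraMap k E)).toAlgebra
  have : IsScalarTower k E L := .of_algebraMap_eq fun _ => rfl
  let φ : E →ₐ[k] L := IsScalarTower.toAlgHom k E L
  obtain ⟨n, ν, κ, δ, c, hn0, hν, hgen, hκ, hc, hδ, hδd, hrel⟩ :=
    exists_discriminant_of_isH8Extension hk hK4 hMH hMu hNH hNu (IntermediateField.inclusion hKM)
      (IntermediateField.inclusion hKN)
      (φ.comp (IntermediateField.inclusion (le_sup_left : adjoinOver K m ≤ E)))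
      (φ.comp (IntermediateField.inclusion (le_sup_right : N ≤ E))) (fun _ => rfl)
      (m := ⟨m, mem_adjoinOver_self K m⟩) (μ := μ) (Subtype.ext hm)
      (by
        rintro ⟨x, hx⟩
        have hx' : (x : Ω) = m := congrArg Subtype.val hx
        exact hmK (hx' ▸ x.2))
  have hδ1 : ∃ (δ' : ℤ) (c' : K), IsQuadraticDiscriminant δ' ∧ δ' ∣ NumberField.discr k ∧
      c' ≠ 0 ∧ κ ^ 2 * μ * ν = δ' * c' ^ 2 := by
    have hcK : algebraMap k K c ≠ 0 := by simpa using hc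
    -- δ = 1 is not a quadratic discriminant; d₁ replaces it, being a square in K and a divisor of
    -- d.
    rcases hδ with rfl | hδ
    · have hs₁K : s₁ ∈ K := by
        rw [hK]
        exact IntermediateField.subset_adjoin _ _ (by simp)
      let t : K := ⟨s₁, hs₁K⟩
      have ht : t ^ 2 = d₁ := Subtype.ext (by simpa using hs₁)
      have hd0 : d₁ ≠ 0 := by
        rintro rfl
        exact NumberField.discr_ne_zero k (by rw [hd]; ring)
      have ht0 : t ≠ 0 := by
        intro h
        rw [h] at ht
        have : (d₁ : K) = 0 := by simpa using ht.symm
        exact hd0 (by exact_mod_cast this)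
      refine ⟨d₁, algebraMap k K c / t, hd₁, ⟨d₂ * d₃, by rw [hd]; ring⟩, div_ne_zero hcK ht0, ?_⟩
      rw [hrel, ← ht]
      rw [Int.cast_one, one_mul, map_pow]
      field_simp
    · exact ⟨δ, algebraMap k K c, hδ, hδd, hcK, by rw [hrel]; simp⟩
  obtain ⟨δ', c', hδ', hδd', hc', hrel'⟩ := hδ1
  have hμ0 : μ ≠ 0 := by
    rintro rfl
    have : m = 0 := by simpa using hm
    exact hmK (this ▸ K.zero_mem)
  -- Chosen so that e²ν = μ(κ²μν)/c'² = δ'μ, which makes e·n a square root of δ'μ.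
  let e : K := μ * κ / c'
  have he : e ≠ 0 := div_ne_zero (mul_ne_zero hμ0 hκ) hc'
  have heΩ : (e : Ω) ≠ 0 := by simpa using he
  have hνΩ : (n : Ω) ^ 2 = (ν : Ω) := congrArg Subtype.val hν
  refine ⟨δ', hδ', hδd', e * n, ?_, le_antisymm ?_ ?_⟩
  · have h1 : e ^ 2 * ν = δ' * μ := by
      have : e ^ 2 * ν = μ * (κ ^ 2 * μ * ν) / c' ^ 2 := by
        simp only [e]
        ring
      rw [this, hrel']
      field_simp
    rw [mul_pow, hνΩ]
    have := congrArg (Subtype.val : K → Ω) h1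
    simpa using this
  · intro x hx
    obtain ⟨α, β, hαβ⟩ := hgen ⟨x, hx⟩
    have hx' : x = α + β * n := congrArg Subtype.val hαβ
    have hKle := le_adjoinOver K ((e : Ω) * n)
    have hn : (n : Ω) ∈ adjoinOver K ((e : Ω) * n) := by
      have := mul_mem (hKle (e⁻¹).2) (mem_adjoinOver_self K ((e : Ω) * n))
      rwa [IntermediateField.coe_inv, inv_mul_cancel_left₀ heΩ] at this
    rw [hx']
    exact add_mem (hKle α.2) (mul_mem (hKle β.2) hn)
  · exact adjoinOver_le hKN (mul_mem (hKN e.2) n.2)
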